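/- Consider the system $x(k+1)=Ax(k)+w(k)$, $x(0)=x_0$, $y(k)=Cx(k)+v(k)$, with $A\in\mathbb R^{n\times n}$, $C\in\mathbb R^{m\times n}$, where $w$ and $v$ are mutually independent (wide-sense) white noises with mean zero and covariances $Q\ge 0$ and $R>0$, $R$ diagonal, and where $x_0$ has mean $\bar x_0$ and covariance $\Pi_0$ and is independent of $(w,v)$. The $m$ measurements are sent over $m$ packet drop channels: the estimator receives $y_{\rm r}(k)=\Gamma(k)y(k)$, $\Gamma(k)=\mathrm{diag}\{\gamma_1(k),\dots,\gamma_m(k)\}$, where $\gamma_1,\dots,\gamma_m$ are mutually independent time-homogeneous Markov chains on $\{0,1\}$, jointly independent of $(x_0,w,v)$, with recovery rates $q_l=\Pr\{\gamma_l(k+1)=1\mid\gamma_l(k)=0\}\in(0,1)$ and failure rates $p_l=\Pr\{\gamma_l(k+1)=0\mid\gamma_l(k)=1\}\in(0,1)$. Let $\theta(k)=1+\sum_{l=1}^m2^{l-1}\gamma_l(k)\in\{1,\dots,N\}$, $N=2^m$, be the mode. It is a Markov chain; let $p_{ij}$ be its transition probabilities (products of those of the channels) and $\mu_i$ its stationary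 distribution (the product of the stationary distributions $\left(\frac{p_l}{p_l+q_l},\frac{q_l}{p_l+q_l}\right)$ of the channels on $(0,1)$). For mode $i$ let $D_i$ be the corresponding value of $\Gamma$, and $H_i=D_iC$. For gains $L=(L_1,\dots,L_N)$, $L_i\in\mathbb R^{n\times m}$, and an initial estimate $\hat x(0)\in\mathbb R^n$, the jump estimator is $\hat x(k+1)=A\hat x(k)+L_{\theta(k)}[y_{\rm r}(k)-H_{\theta(k)}\hat x(k)]$, with cost $J_L(k)=\mathrm E\,\|x(k)-\hat x(k)\|^2$. The gains $L$ are called mean-square (MS) stable if the operator $V\mapsto\big(\sum_{i}p_{ij}(A-L_iH_i)V_i(A-L_iH_i)'\big)_{j}$ on $N$-tuples of $n\times n$ matrices has spectral radius less than $1$. Assume that the coupled algebraic Riccati equations (CAREs) $$Y_j=\sum_{i=1}^Np_{ij}\big[AY_iA'-AY_iH_i'(H_iY_iH_i'+\mu_iR)^{-1}H_iY_iA'+\mu_iQ\big],\qquad j=1,\dots,N,$$ have an MS stabilizing solution $Y=(Y_1,\dots,Y_N)$, that is, a solution with all $Y_i\ge0$ for which the gains $$K_j=AY_jH_j'(H_jY_jH_j'+\mu_jR)^{-1},\qquad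 j=1,\dots,N,$$ are MS stable. Then the gains $K_j$ are optimal stationary gains of the jump estimator, and the optimal stationary cost is $\sum_{i}\mathrm{tr}(Y_i)$. Precisely: 1. for every $\hat x(0)\in\mathbb R^n$, $\lim_{k\to\infty}J_K(k)=\sum_{i=1}^N\mathrm{tr}(Y_i)$; 2. for all MS stable gains $L$ and every $\hat x(0)\in\mathbb R^n$, $\liminf_{k\to\infty}J_L(k)\ge\sum_{i=1}^N\mathrm{tr}(Y_i)$; 3. if $\Pi_0$ is positive definite, then the inequality in 2 holds for all gains $L$, MS stable or not, and every $\hat x(0)\in\mathbb R^n$. -/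

import Mathlib

open Filter Topology MeasureTheory ProbabilityTheory
open scoped Matrix ENNReal

namespace PacketDrop

/-- The mode of the jump system: the arrival pattern of the `m` channels, `true` meaning that the
packet arrives (`γ = 1`) and `false` that it is dropped (`γ = 0`). There are `N = 2 ^ m` modes; the
pattern `γ` carries the label `1 + ∑ i, 2 ^ (i - 1) * γ i`. -/
abbrev Mode (m : ℕ) : Type := Fin m → Bool

/-- Transition probabilities of one channel with failure rate `p` and recovery rate `q`. -/
def tpm (p q : ℝ) : Bool → Bool → ℝ
  | false, false => 1 - q
  | false, true => q
  | true, false => p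
  | true, true => 1 - p

/-- Limit distribution of one channel with failure rate `p` and recovery rate `q`. -/
noncomputable def limitProb (p q : ℝ) : Bool → ℝ
  | false => p / (p + q)
  | true => q / (p + q)

/-- The transition probabilities `p_{ij}` of the mode: the entries of the Kronecker product of the
transition matrices of the channels. -/
def modeTPM {m : ℕ} (p q : Fin m → ℝ) (i j : Mode m) : ℝ :=
  ∏ l, tpm (p l) (q l) (i l) (j l)

/-- The stationary distribution `μ_i` of the mode: the entries of the Kronecker product of the
limit distributions of the channels. -/
noncomputable def modeProb {m : ℕ} (p q : Fin m → ℝ) (i : Mode m) : ℝ :=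
  ∏ l, limitProb (p l) (q l) (i l)

/-- `D_i = diag {γ_1, …, γ_m}` for the mode `i = (γ_1, …, γ_m)`. -/
def dropMat {m : ℕ} (i : Mode m) : Matrix (Fin m) (Fin m) ℝ :=
  Matrix.diagonal fun l => if i l = true then 1 else 0

/-- `H_i = D_i C`. -/
def obsMat {n m : ℕ} (C : Matrix (Fin m) (Fin n) ℝ) (i : Mode m) : Matrix (Fin m) (Fin n) ℝ :=
  dropMat i * C

/-- The operator `V ↦ (∑ i, p_{ij} (A + L_i H_i) V_i (A + L_i H_i)')_j` on families of real
matrices indexed by the modes. -/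
noncomputable def gainOp {n m : ℕ} (A : Matrix (Fin n) (Fin n) ℝ) (C : Matrix (Fin m) (Fin n) ℝ)
    (p q : Fin m → ℝ) (L : Mode m → Matrix (Fin n) (Fin m) ℝ) :
    (Mode m → Matrix (Fin n) (Fin n) ℝ) →ₗ[ℝ] (Mode m → Matrix (Fin n) (Fin n) ℝ) where
  toFun V j := ∑ i, modeTPM p q i j •
    ((A + L i * obsMat C i) * V i * (A + L i * obsMat C i)ᵀ)
  map_add' V W := by
    funext j
    simp only [Pi.add_apply, Matrix.mul_add, Matrix.add_mul, smul_add, Finset.sum_add_distrib]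
  map_smul' c V := by
    funext j
    simp only [Pi.smul_apply, Matrix.mul_smul, Matrix.smul_mul, RingHom.id_apply, Finset.smul_sum]
    exact Finset.sum_congr rfl fun i _ => smul_comm _ _ _

/-- The spectral radius of an endomorphism of a real vector space, that is, the spectral radius of
its complexification. -/
noncomputable def realSpectralRadius {E : Type*} [AddCommGroup E] [Module ℝ E]
    (T : E →ₗ[ℝ] E) : ℝ≥0∞ :=
  spectralRadius ℂ (T.baseChange ℂ : Module.End ℂ (TensorProduct ℝ ℂ E))

/-- The gains `L` of the jump estimator make its error dynamics, whose system matrix is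
`A - L_i H_i` in mode `i`, mean-square stable. -/
def IsMSStable {n m : ℕ} (A : Matrix (Fin n) (Fin n) ℝ) (C : Matrix (Fin m) (Fin n) ℝ)
    (p q : Fin m → ℝ) (L : Mode m → Matrix (Fin n) (Fin m) ℝ) : Prop :=
  realSpectralRadius (gainOp A C p q (fun i => -L i)) < 1

/-- The matrix `H_i Y_i H_i' + μ_i R`. -/
noncomputable def innovMat {n m : ℕ} (C : Matrix (Fin m) (Fin n) ℝ) (R : Matrix (Fin m) (Fin m) ℝ)
    (p q : Fin m → ℝ) (Y : Mode m → Matrix (Fin n) (Fin n) ℝ) (i : Mode m) :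
    Matrix (Fin m) (Fin m) ℝ :=
  obsMat C i * Y i * (obsMat C i)ᵀ + modeProb p q i • R

/-- The gain `K_i(Y) = A Y_i H_i' (H_i Y_i H_i' + μ_i R)⁻¹`. -/
noncomputable def kalmanGain {n m : ℕ} (A : Matrix (Fin n) (Fin n) ℝ)
    (C : Matrix (Fin m) (Fin n) ℝ) (R : Matrix (Fin m) (Fin m) ℝ) (p q : Fin m → ℝ)
    (Y : Mode m → Matrix (Fin n) (Fin n) ℝ) (i : Mode m) : Matrix (Fin n) (Fin m) ℝ :=
  A * Y i * (obsMat C i)ᵀ * (innovMat C R p q Y i)⁻¹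

/-- The coupled algebraic Riccati equations. -/
def SolvesCARE {n m : ℕ} (A : Matrix (Fin n) (Fin n) ℝ) (C : Matrix (Fin m) (Fin n) ℝ)
    (Q : Matrix (Fin n) (Fin n) ℝ) (R : Matrix (Fin m) (Fin m) ℝ) (p q : Fin m → ℝ)
    (Y : Mode m → Matrix (Fin n) (Fin n) ℝ) : Prop :=
  ∀ j, Y j = ∑ i, modeTPM p q i j •
    (A * Y i * Aᵀ
      - A * Y i * (obsMat C i)ᵀ * (innovMat C R p q Y i)⁻¹ * obsMat C i * Y i * Aᵀ
      + modeProb p q i • Q)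

/-- Mean-square stabilizing solutions of the coupled algebraic Riccati equations. -/
structure IsMSStabilizingSolution {n m : ℕ} (A : Matrix (Fin n) (Fin n) ℝ)
    (C : Matrix (Fin m) (Fin n) ℝ) (Q : Matrix (Fin n) (Fin n) ℝ) (R : Matrix (Fin m) (Fin m) ℝ)
    (p q : Fin m → ℝ) (Y : Mode m → Matrix (Fin n) (Fin n) ℝ) : Prop where
  posSemidef : ∀ i, (Y i).PosSemidef
  care : SolvesCARE A C Q R p q Y
  stable : IsMSStable A C p q (kalmanGain A C R p q Y)

/-- `X` is a time-homogeneous Markov chain on `S` with transition probabilities `T`: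
`Pr (X_0 = a_0, …, X_{k+1} = a_{k+1}) = Pr (X_0 = a_0, …, X_k = a_k) * T a_k a_{k+1}`. -/
def IsMarkovChain {Ω S : Type*} [MeasurableSpace Ω] (P : Measure Ω) (X : ℕ → Ω → S)
    (T : S → S → ℝ) : Prop :=
  ∀ (k : ℕ) (a : ℕ → S), P {ω | ∀ l ≤ k + 1, X l ω = a l} =
    P {ω | ∀ l ≤ k, X l ω = a l} * ENNReal.ofReal (T (a k) (a (k + 1)))

/-- `u` is a (wide-sense) white noise with mean zero and covariance matrix `S`. -/
structure IsWhiteNoise {Ω : Type*} [MeasurableSpace Ω] (P : Measure Ω) {d : ℕ}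
    (u : ℕ → Ω → Fin d → ℝ) (S : Matrix (Fin d) (Fin d) ℝ) : Prop where
  measurable : ∀ k, Measurable (u k)
  memLp : ∀ k a, MemLp (fun ω => u k ω a) 2 P
  mean : ∀ k a, ∫ ω, u k ω a ∂P = 0
  covariance : ∀ k l a b, ∫ ω, u k ω a * u l ω b ∂P = if k = l then S a b else 0

/-- The stochastic assumptions on the initial state `x₀`, the process noise `w`, the measurement
noise `v` and the channel states `γ i k` (channel `i`, time `k`). -/
structure IsPacketDropModel {Ω : Type*} [MeasurableSpace Ω] (P : Measure Ω) {n m : ℕ}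
    (Q : Matrix (Fin n) (Fin n) ℝ) (R : Matrix (Fin m) (Fin m) ℝ) (p q : Fin m → ℝ)
    (xbar : Fin n → ℝ) (Pi0 : Matrix (Fin n) (Fin n) ℝ)
    (x₀ : Ω → Fin n → ℝ) (w : ℕ → Ω → Fin n → ℝ) (v : ℕ → Ω → Fin m → ℝ)
    (γ : Fin m → ℕ → Ω → Bool) : Prop where
  noise_w : IsWhiteNoise P w Q
  noise_v : IsWhiteNoise P v R
  indep_noise : IndepFun (fun ω k => w k ω) (fun ω k => v k ω) P
  measurable_init : Measurable x₀
  memLp_init : ∀ a, MemLp (fun ω => x₀ ω a) 2 P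
  mean_init : ∀ a, ∫ ω, x₀ ω a ∂P = xbar a
  cov_init : ∀ a b, ∫ ω, (x₀ ω a - xbar a) * (x₀ ω b - xbar b) ∂P = Pi0 a b
  indep_init : IndepFun x₀ (fun ω => ((fun k => w k ω), (fun k => v k ω))) P
  measurable_channel : ∀ i k, Measurable (γ i k)
  markov : ∀ i, IsMarkovChain P (γ i) (tpm (p i) (q i))
  indep_channels : iIndepFun (fun i ω k => γ i k ω) P
  indep_channels_noise :
    IndepFun (fun ω i k => γ i k ω) (fun ω => (x₀ ω, (fun k => w k ω), (fun k => v k ω))) P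

/-- The state: `x(k+1) = A x(k) + w(k)`, `x(0) = x₀`. -/
def state {n : ℕ} (A : Matrix (Fin n) (Fin n) ℝ) (x₀ : Fin n → ℝ) (w : ℕ → Fin n → ℝ) :
    ℕ → Fin n → ℝ
  | 0 => x₀
  | k + 1 => A *ᵥ state A x₀ w k + w k

/-- The received signal `y_r(k) = Γ(k) (C x(k) + v(k))`, where `θ k` is the mode at time `k`. -/
def received {n m : ℕ} (C : Matrix (Fin m) (Fin n) ℝ) (θ : ℕ → Mode m) (x : ℕ → Fin n → ℝ)
    (v : ℕ → Fin m → ℝ) (k : ℕ) : Fin m → ℝ :=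
  dropMat (θ k) *ᵥ (C *ᵥ x k + v k)

/-- The jump estimator with gains `L`, started at `z₀`:
`z(k+1) = A z(k) + L_{θ(k)} (y_r(k) - H_{θ(k)} z(k))`. -/
def estimate {n m : ℕ} (A : Matrix (Fin n) (Fin n) ℝ) (C : Matrix (Fin m) (Fin n) ℝ)
    (L : Mode m → Matrix (Fin n) (Fin m) ℝ) (θ : ℕ → Mode m) (y : ℕ → Fin m → ℝ)
    (z₀ : Fin n → ℝ) : ℕ → Fin n → ℝ
  | 0 => z₀
  | k + 1 => A *ᵥ estimate A C L θ y z₀ k +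
      L (θ k) *ᵥ (y k - obsMat C (θ k) *ᵥ estimate A C L θ y z₀ k)

/-- The mean-square error `J(k) = E ‖x(k) - x̂(k)‖²` (Euclidean norm) of the jump estimator with
gains `L` and initial estimate `z₀`. -/
noncomputable def cost {Ω : Type*} [MeasurableSpace Ω] (P : Measure Ω) {n m : ℕ}
    (A : Matrix (Fin n) (Fin n) ℝ) (C : Matrix (Fin m) (Fin n) ℝ)
    (x₀ : Ω → Fin n → ℝ) (w : ℕ → Ω → Fin n → ℝ) (v : ℕ → Ω → Fin m → ℝ)
    (γ : Fin m → ℕ → Ω → Bool) (L : Mode m → Matrix (Fin n) (Fin m) ℝ) (z₀ : Fin n → ℝ)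
    (k : ℕ) : ℝ≥0∞ :=
  ∫⁻ ω,
    let θ : ℕ → Mode m := fun k i => γ i k ω
    let x : ℕ → Fin n → ℝ := state A (x₀ ω) (fun k => w k ω)
    let y : ℕ → Fin m → ℝ := received C θ x (fun k => v k ω)
    ENNReal.ofReal (‖WithLp.toLp 2 (x k - estimate A C L θ y z₀ k)‖ ^ 2) ∂P

end PacketDrop

/-! The error `e = x - x̂` obeys a linear recursion driven by the noises, with coefficients chosen
by the mode. Since the channels are independent of `(x₀, w, v)`, the noises can be averaged out
along a fixed mode path, and then the path averaged by the Markov property. The mode-restricted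
second moments `X_j(k) = E[e(k) e(k)' 1{θ(k) = j}]` therefore satisfy `X(k+1) = T_L X(k) +
B_L(π(k))`, where `T_L` is a positive linear operator and `B_L(π(k))` is the noise covariance
weighted by the mode law `π(k)`; the cost is the total trace of `X(k)` (`isErrorCovariance_modeCov`,
`cost_eq`).

Completing squares in the CAREs gives `Y + G_L = T_L Y + B_L(μ)` with `G_L ≥ 0`, and `G_K = 0`
(`care_completion`, `excess_kalmanGain`). As `π(k) → μ`, the input is eventually between `c B_L(μ)`
and `c' B_L(μ)` for any `c < 1 < c'`. Comparing orbits of positive affine recursions in the Loewner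
order gives `X(s+t) ≥ c (Y - T_L^t Y)` for all gains and `X(s+t) ≤ c' Y + T_K^t X(s)` for `K`. When
the powers of the operator vanish, these bounds yield claims 1 and 2.

For unstable gains and `Π₀ > 0`, the covariance dominates `c Y` after one step
(`exists_smul_le_first`), hence `X(1+t) ≥ c (Y + ∑_{s<t} T_L^s G_L)`. If the traces of these sums
are unbounded, the cost diverges. If they are bounded, a Lyapunov family for `T_K` is perturbed into
one for `T_L` with an error controlled by `G_L`; this forces `T_L^t → 0`
(`tendsto_of_bounded_excess`), and the argument of claim 2 applies. -/

namespace PacketDrop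

/-! ### Spectral radius and geometric decay -/

/-- An element of spectral radius less than `1` of a finite-dimensional normed algebra has powers
that decay geometrically. -/
theorem exists_rate_normed {R : Type*} [NormedRing R] [NormedAlgebra ℂ R] [FiniteDimensional ℂ R]
    (M : R) (hM : spectralRadius ℂ M < 1) :
    ∃ r : ℝ, 1 < r ∧ ∀ g : R →ₗ[ℂ] ℂ,
      Tendsto (fun k : ℕ => r ^ k * ‖g (M ^ k)‖) atTop (𝓝 0) := by
  have : CompleteSpace R := FiniteDimensional.complete ℂ R
  obtain ⟨s, hs, hs1⟩ := ENNReal.lt_iff_exists_nnreal_btwn.1 hM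
  have hs1 : s < 1 := by exact_mod_cast hs1
  have hs0 : 0 < s := by
    have : (0 : ℝ≥0∞) < s := lt_of_le_of_lt zero_le hs
    exact_mod_cast this
  have hs0' : (0 : ℝ) < s := hs0
  have hs1' : (s : ℝ) < 1 := hs1
  -- The rate `r` is the midpoint of `1` and `1 / s`, so `r * s = (1 + s) / 2 < 1`, while Gelfand's
  -- formula gives `‖M ^ k‖ ≤ s ^ k` eventually.
  refine ⟨(1 + 1 / s) / 2, ?_, fun g => ?_⟩
  · have : 1 < 1 / (s : ℝ) := by rw [lt_div_iff₀ hs0']; simpa using hs1'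
    linarith
  · have hev : ∀ᶠ k : ℕ in atTop, ‖M ^ k‖ ≤ (s : ℝ) ^ k := by
      filter_upwards [(spectrum.pow_nnnorm_pow_one_div_tendsto_nhds_spectralRadius M).eventually
        (gt_mem_nhds hs), eventually_gt_atTop 0] with k hk hk0
      have h1 : (‖M ^ k‖₊ : ℝ≥0∞) ≤ (s : ℝ≥0∞) ^ k := by
        have h2 := ENNReal.rpow_le_rpow hk.le (Nat.cast_nonneg k)
        rw [← ENNReal.rpow_mul, one_div_mul_cancel (by positivity), ENNReal.rpow_one,
          ENNReal.rpow_natCast] at h2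
        exact h2
      exact_mod_cast h1
    have hg : Continuous g := LinearMap.continuous_of_finiteDimensional g
    let G : R →L[ℂ] ℂ := ⟨g, hg⟩
    have hlim : Tendsto (fun k : ℕ => ‖G‖ * ((1 + s) / 2 : ℝ) ^ k) atTop (𝓝 0) := by
      simpa using (tendsto_pow_atTop_nhds_zero_of_lt_one (by positivity)
        (by linarith : ((1 + s) / 2 : ℝ) < 1)).const_mul ‖G‖
    refine squeeze_zero' (Eventually.of_forall fun k => by positivity) ?_ hlim
    filter_upwards [hev] with k hk
    have h3 : ‖g (M ^ k)‖ ≤ ‖G‖ * (s : ℝ) ^ k :=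
      (G.le_opNorm (M ^ k)).trans (mul_le_mul_of_nonneg_left hk (norm_nonneg _))
    calc ((1 + 1 / s) / 2 : ℝ) ^ k * ‖g (M ^ k)‖
        ≤ ((1 + 1 / s) / 2 : ℝ) ^ k * (‖G‖ * (s : ℝ) ^ k) := by gcongr
      _ = ‖G‖ * (((1 + 1 / s) / 2 : ℝ) * s) ^ k := by rw [mul_pow]; ring
      _ = _ := by
        congr 2
        field_simp
        ring

attribute [local instance] Matrix.linftyOpNormedRing Matrix.linftyOpNormedAlgebra in
/-- A complex matrix of spectral radius less than `1` has powers that decay geometrically. -/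
theorem exists_rate_matrix {ι : Type*} [Fintype ι] [DecidableEq ι] (M : Matrix ι ι ℂ)
    (hM : spectralRadius ℂ M < 1) :
    ∃ r : ℝ, 1 < r ∧ ∀ g : Matrix ι ι ℂ →ₗ[ℂ] ℂ,
      Tendsto (fun k : ℕ => r ^ k * ‖g (M ^ k)‖) atTop (𝓝 0) :=
  exists_rate_normed M hM

/-- An endomorphism of spectral radius less than `1` has iterates that decay geometrically. -/
theorem exists_rate {E : Type*} [AddCommGroup E] [Module ℝ E] [Module.Finite ℝ E]
    (T : E →ₗ[ℝ] E) (hT : realSpectralRadius T < 1) :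
    ∃ r : ℝ, 1 < r ∧ ∀ (f : E →ₗ[ℝ] ℝ) (x : E),
      Tendsto (fun k : ℕ => r ^ k * f ((T ^ k) x)) atTop (𝓝 0) := by
  classical
  let b := Module.finBasis ℝ E
  let M : Matrix _ _ ℝ := LinearMap.toMatrixAlgEquiv b T
  let Mc := M.map (algebraMap ℝ ℂ)
  have hMc : Mc = LinearMap.toMatrixAlgEquiv (Algebra.TensorProduct.basis ℂ b)
      (T.baseChange ℂ : Module.End ℂ (TensorProduct ℝ ℂ E)) :=
    (LinearMap.toMatrix_baseChange ℂ T b b).symm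
  have hrad : spectralRadius ℂ Mc < 1 := by
    unfold realSpectralRadius at hT
    unfold spectralRadius at hT ⊢
    rwa [hMc, AlgEquiv.spectrum_eq]
  obtain ⟨r, hr, h⟩ := exists_rate_matrix Mc hrad
  refine ⟨r, hr, fun f x => ?_⟩
  -- The matrix coefficient for the vector `x` and the functional `f`, chosen so that `g (Mc ^ k) =
  -- f ((T ^ k) x)`.
  let g : Matrix (Fin (Module.finrank ℝ E)) (Fin (Module.finrank ℝ E)) ℂ →ₗ[ℂ] ℂ :=
    { toFun := fun N => ∑ i, ∑ j, N i j * ((b.repr x j : ℝ) * (f (b i) : ℝ) : ℂ)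
      map_add' := fun N N' => by
        simp only [Matrix.add_apply, add_mul, Finset.sum_add_distrib]
      map_smul' := fun c N => by
        simp only [Matrix.smul_apply, smul_eq_mul, mul_assoc, Finset.mul_sum, RingHom.id_apply] }
  have hg : ∀ k : ℕ, g (Mc ^ k) = (f ((T ^ k) x) : ℝ) := by
    intro k
    have h1 : Mc ^ k = (M ^ k).map (algebraMap ℝ ℂ) := by
      simp only [Mc]
      exact (map_pow (algebraMap ℝ ℂ).mapMatrix M k).symm
    have h2 : M ^ k = LinearMap.toMatrixAlgEquiv b (T ^ k) := (map_pow _ T k).symm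
    have h3 : f ((T ^ k) x) = ∑ i, ∑ j, (M ^ k) i j * (b.repr x j * f (b i)) := by
      have h4 : (T ^ k) x = ∑ i, (∑ j, (M ^ k) i j * b.repr x j) • b i := by
        conv_lhs => rw [← b.sum_repr ((T ^ k) x)]
        refine Finset.sum_congr rfl fun i _ => ?_
        congr 1
        have h5 := congrFun (LinearMap.toMatrix_mulVec_repr b b (T ^ k) x) i
        rw [← h5, h2]
        rfl
      rw [h4, map_sum]
      refine Finset.sum_congr rfl fun i _ => ?_
      rw [map_smul, smul_eq_mul, Finset.sum_mul]
      exact Finset.sum_congr rfl fun j _ => by ring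
    rw [h3, h1]
    simp only [g, LinearMap.coe_mk, AddHom.coe_mk, Matrix.map_apply]
    push_cast
    rfl
  have := h g
  simp only [hg] at this
  rw [tendsto_zero_iff_norm_tendsto_zero]
  refine this.congr fun k => ?_
  rw [norm_mul, Complex.norm_real, norm_pow, Real.norm_of_nonneg (by linarith : 0 ≤ r)]

/-! ### Positive operators on ordered vector spaces -/

theorem pow_apply_nonneg {E : Type*} [AddCommGroup E] [PartialOrder E] [Module ℝ E]
    {T : E →ₗ[ℝ] E} (hT : ∀ x, 0 ≤ x → 0 ≤ T x) (k : ℕ) {x : E} (hx : 0 ≤ x) :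
    0 ≤ (T ^ k) x := by
  induction k with
  | zero => simpa using hx
  | succ k ih => rw [pow_succ', Module.End.mul_apply]; exact hT _ ih

theorem map_le_map_of_nonneg {E : Type*} [AddCommGroup E] [PartialOrder E] [IsOrderedAddMonoid E]
    [Module ℝ E] {F : Type*} [AddCommGroup F] [PartialOrder F] [IsOrderedAddMonoid F]
    [Module ℝ F] {T : E →ₗ[ℝ] F} (hT : ∀ x, 0 ≤ x → 0 ≤ T x) {x y : E} (h : x ≤ y) :
    T x ≤ T y := by
  have := hT _ (sub_nonneg.2 h)
  rwa [map_sub, sub_nonneg] at this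

section OrderedDynamics

set_option linter.unusedSectionVars false

variable {E : Type*} [AddCommGroup E] [PartialOrder E] [IsOrderedAddMonoid E] [Module ℝ E]
  [PosSMulMono ℝ E]

/-- A positive operator whose iterates decay geometrically has a Lyapunov element. -/
theorem exists_lyapunov {T : E →ₗ[ℝ] E} (hT : ∀ x, 0 ≤ x → 0 ≤ T x) {τ : E →ₗ[ℝ] ℝ} {e : E}
    (he : 0 ≤ e) (hτe : ∀ x, 0 ≤ x → x ≤ τ x • e) {r : ℝ} (hr : 1 < r)
    (hlim : Tendsto (fun k : ℕ => r ^ k * τ ((T ^ k) e)) atTop (𝓝 0)) :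
    ∃ P, 0 ≤ P ∧ e + r • T P ≤ P := by
  -- A truncated Neumann series for `(1 - r T)⁻¹ e` suffices: its remainder `r ^ N • (T ^ N) e` is
  -- at most `e / 2`, so no convergence in `E` is needed.
  obtain ⟨N, hN⟩ := (hlim.eventually (gt_mem_nhds (by norm_num : (0 : ℝ) < 1 / 2))).exists
  let P0 := ∑ k ∈ Finset.range N, r ^ k • (T ^ k) e
  have hP0 : 0 ≤ P0 := Finset.sum_nonneg fun k _ =>
    smul_nonneg (by positivity) (pow_apply_nonneg hT k he)
  have h1 : e + r • T P0 = P0 + r ^ N • (T ^ N) e := by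
    have : r • T P0 = ∑ k ∈ Finset.range N, r ^ (k + 1) • (T ^ (k + 1)) e := by
      simp only [P0, map_sum, Finset.smul_sum, map_smul, smul_smul, pow_succ' T,
        Module.End.mul_apply, pow_succ' r]
    rw [this]
    simp only [P0]
    have h2 := Finset.sum_range_succ (fun k => r ^ k • (T ^ k) e) N
    rw [← h2, Finset.sum_range_succ']
    simp [add_comm]
  have h2 : r ^ N • (T ^ N) e ≤ (1 / 2 : ℝ) • e := by
    have h3 := hτe _ (pow_apply_nonneg hT N he)
    calc r ^ N • (T ^ N) e ≤ r ^ N • (τ ((T ^ N) e) • e) :=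
          smul_le_smul_of_nonneg_left h3 (by positivity)
      _ = (r ^ N * τ ((T ^ N) e)) • e := smul_smul _ _ _
      _ ≤ (1 / 2 : ℝ) • e := by
          have h5 := smul_nonneg (sub_nonneg.2 hN.le) he
          rwa [sub_smul, sub_nonneg] at h5
  -- Doubling turns `e + r T P0 ≤ P0 + e / 2` into `2 e + r T P ≤ P + e`, which leaves exactly one
  -- `e` to spare.
  refine ⟨(2 : ℝ) • P0, smul_nonneg (by norm_num) hP0, ?_⟩
  have h4 : e + r • T P0 ≤ P0 + (1 / 2 : ℝ) • e := h1 ▸ add_le_add_right h2 P0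
  have h5 := smul_le_smul_of_nonneg_left h4 (by norm_num : (0 : ℝ) ≤ 2)
  rw [smul_add, smul_add, smul_smul 2 (1 / 2 : ℝ), smul_comm, ← map_smul] at h5
  norm_num at h5
  rw [two_smul ℝ e, add_assoc, add_comm, add_assoc, add_comm] at h5
  have h6 := add_le_add_iff_right e |>.1 (by simpa [add_comm, add_left_comm, add_assoc] using h5)
  simpa [add_comm] using h6

/-- If a Lyapunov element `P` of `S` satisfies `T P ≤ r S P + c G` and the iterates of `G` under `T`
have bounded total mass, then the iterates of `e` under `T` vanish. -/
theorem tendsto_zero_of_bounded_excess {S T : E →ₗ[ℝ] E} (hT : ∀ x, 0 ≤ x → 0 ≤ T x)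
    {τ : E →ₗ[ℝ] ℝ} (hτ : ∀ x, 0 ≤ x → 0 ≤ τ x) {e P G : E} (he : 0 ≤ e) (hP : 0 ≤ P) {r c b : ℝ}
    (hlyap : e + r • S P ≤ P) (hTP : T P ≤ r • S P + c • G) (hc : 0 ≤ c)
    (hb : ∀ k, ∑ t ∈ Finset.range k, τ ((T ^ t) G) ≤ b) :
    Tendsto (fun t : ℕ => τ ((T ^ t) e)) atTop (𝓝 0) := by
  have hpos : ∀ t x, 0 ≤ x → 0 ≤ (τ ∘ₗ T ^ t) x := fun t x hx => hτ _ (pow_apply_nonneg hT t hx)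
  -- Eliminating `r • S P` gives `T P + e ≤ P + c G`: `P` is a Lyapunov element for `T` up to the
  -- excess. Applying `τ ∘ T ^ t` and telescoping makes the masses of `(T ^ t) e` summable.
  have hstep : ∀ t, τ ((T ^ (t + 1)) P) + τ ((T ^ t) e) ≤ τ ((T ^ t) P) + c * τ ((T ^ t) G) := by
    intro t
    have h1 : T P + e ≤ P + c • G := by
      calc T P + e ≤ (r • S P + c • G) + e := by gcongr
        _ = (e + r • S P) + c • G := by abel
        _ ≤ P + c • G := by gcongr
    have h2 := map_le_map_of_nonneg (hpos t) h1
    simpa [pow_succ, map_add, map_smul] using h2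
  have hsum : ∀ k, τ ((T ^ k) P) + ∑ t ∈ Finset.range k, τ ((T ^ t) e) ≤
      τ P + c * ∑ t ∈ Finset.range k, τ ((T ^ t) G) := by
    intro k
    induction k with
    | zero => simp
    | succ k ih =>
      rw [Finset.sum_range_succ, Finset.sum_range_succ, mul_add]
      linarith [hstep k]
  have hs : Summable fun t => τ ((T ^ t) e) := by
    refine summable_of_sum_range_le (c := τ P + c * b) (fun t => hpos t e he) fun k => ?_
    have h1 := hsum k
    have h2 := mul_le_mul_of_nonneg_left (hb k) hc
    have h3 : 0 ≤ τ ((T ^ k) P) := hpos k P hP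
    linarith
  exact hs.tendsto_atTop_zero

variable {T : E →ₗ[ℝ] E} (hT : ∀ x, 0 ≤ x → 0 ≤ T x) {Y B G : E} (hY : Y + G = T Y + B)

include hT hY

/-- If `G = 0`, then `c (Y - T^t Y)` is the orbit of `Z ↦ T Z + c B` started at `0`; for `G ≥ 0` it
is still a subsolution. -/
theorem lower_orbit_bound (hG : 0 ≤ G) {X : ℕ → E} {c : ℝ} (hc : 0 ≤ c)
    (hX : ∀ k, T (X k) + c • B ≤ X (k + 1)) (hX0 : 0 ≤ X 0) (t : ℕ) :
    c • (Y - (T ^ t) Y) ≤ X t := by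
  induction t with
  | zero => simpa using hX0
  | succ t ih =>
    refine le_trans ?_ (hX t)
    have h1 := map_le_map_of_nonneg hT ih
    rw [map_smul, map_sub, ← Module.End.mul_apply, ← pow_succ'] at h1
    calc c • (Y - (T ^ (t + 1)) Y) ≤ c • (Y + G - (T ^ (t + 1)) Y) := by
          refine smul_le_smul_of_nonneg_left ?_ hc
          exact sub_le_sub_right (le_add_of_nonneg_right hG) _
      _ = c • (T Y - (T ^ (t + 1)) Y) + c • B := by rw [hY, ← smul_add]; congr 1; abel
      _ ≤ T (X t) + c • B := by gcongr

/-- `Y + ∑_{s<t} T^s G` is exactly the orbit of `Z ↦ T Z + B` started at `Y`: each step adds one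
more propagated copy of the excess. -/
theorem excess_orbit_bound {X : ℕ → E} {c : ℝ}
    (hX : ∀ k, T (X k) + c • B ≤ X (k + 1)) (hX0 : c • Y ≤ X 0) (t : ℕ) :
    c • (Y + ∑ s ∈ Finset.range t, (T ^ s) G) ≤ X t := by
  induction t with
  | zero => simpa using hX0
  | succ t ih =>
    refine le_trans (le_of_eq ?_) ((add_le_add_left (map_le_map_of_nonneg hT ih) _).trans (hX t))
    rw [Finset.sum_range_succ', map_smul, ← smul_add, map_add, map_sum]
    simp only [pow_succ' T, Module.End.mul_apply, pow_zero, Module.End.one_apply]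
    congr 1
    rw [add_right_comm, ← hY]
    abel

/-- Without excess, `c Y` is a fixed point of `Z ↦ T Z + c B`, so the deviation from it is
propagated by `T` alone. -/
theorem upper_orbit_bound (hG : G = 0) {X : ℕ → E} {c : ℝ} (hc : 0 ≤ c) (hY0 : 0 ≤ Y)
    (hX : ∀ k, X (k + 1) ≤ T (X k) + c • B) (t : ℕ) :
    X t ≤ c • Y + (T ^ t) (X 0) := by
  induction t with
  | zero => simpa using smul_nonneg hc hY0
  | succ t ih =>
    refine (hX t).trans ((add_le_add_left (map_le_map_of_nonneg hT ih) _).trans (le_of_eq ?_))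
    rw [hG, add_zero] at hY
    rw [map_add, map_smul, add_right_comm, ← smul_add, ← hY, pow_succ', Module.End.mul_apply]

end OrderedDynamics

/-! ### Loewner order and the error operator -/

section Loewner

open scoped MatrixOrder

theorem conj_nonneg {k l : ℕ} {X : Matrix (Fin k) (Fin k) ℝ} (hX : 0 ≤ X)
    (B : Matrix (Fin l) (Fin k) ℝ) : 0 ≤ B * X * Bᵀ := by
  have := (Matrix.nonneg_iff_posSemidef.1 hX).mul_mul_conjTranspose_same B
  rw [Matrix.conjTranspose_eq_transpose_of_trivial] at this
  exact this.nonneg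

theorem conj_mono {k l : ℕ} {X Z : Matrix (Fin k) (Fin k) ℝ} (h : X ≤ Z)
    (B : Matrix (Fin l) (Fin k) ℝ) : B * X * Bᵀ ≤ B * Z * Bᵀ := by
  have := conj_nonneg (sub_nonneg.2 h) B
  rwa [Matrix.mul_sub, Matrix.sub_mul, sub_nonneg] at this

theorem exists_pos_smul_one_le {k : ℕ} {M : Matrix (Fin k) (Fin k) ℝ} (hM : M.PosDef) :
    ∃ c : ℝ, 0 < c ∧ c • (1 : Matrix (Fin k) (Fin k) ℝ) ≤ M := by
  rcases isEmpty_or_nonempty (Fin k) with h | h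
  · exact ⟨1, one_pos, le_of_eq (Subsingleton.elim _ _)⟩
  · obtain ⟨c, hc, h⟩ := (CFC.exists_pos_algebraMap_le_iff (A := Matrix (Fin k) (Fin k) ℝ)
      hM.isHermitian.isSelfAdjoint).2 fun x hx => by
        rw [hM.isHermitian.spectrum_real_eq_range_eigenvalues] at hx
        obtain ⟨i, rfl⟩ := hx
        exact hM.eigenvalues_pos i
    exact ⟨c, hc, by rwa [Algebra.algebraMap_eq_smul_one] at h⟩

/-- The trace is the sum of the nonnegative eigenvalues, hence bounds each of them. -/
theorem le_trace_smul_one {k : ℕ} {X : Matrix (Fin k) (Fin k) ℝ} (hX : 0 ≤ X) :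
    X ≤ X.trace • (1 : Matrix (Fin k) (Fin k) ℝ) := by
  have hX' := Matrix.nonneg_iff_posSemidef.1 hX
  have h := (le_algebraMap_iff_spectrum_le (R := ℝ) (A := Matrix (Fin k) (Fin k) ℝ)
      (r := X.trace) (a := X) hX'.isHermitian.isSelfAdjoint).2 fun x hx => by
        rw [hX'.isHermitian.spectrum_real_eq_range_eigenvalues] at hx
        obtain ⟨i, rfl⟩ := hx
        rw [hX'.isHermitian.trace_eq_sum_eigenvalues]
        exact Finset.single_le_sum (f := hX'.isHermitian.eigenvalues)
          (fun j _ => hX'.eigenvalues_nonneg j) (Finset.mem_univ i)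
  rwa [Algebra.algebraMap_eq_smul_one] at h

/-- A positive semidefinite matrix is dominated by multiples of a positive definite one. -/
theorem exists_le_smul_posDef {k : ℕ} {X M : Matrix (Fin k) (Fin k) ℝ} (hX : 0 ≤ X)
    (hM : M.PosDef) : ∃ c : ℝ, 0 ≤ c ∧ X ≤ c • M := by
  obtain ⟨b, hb, h⟩ := exists_pos_smul_one_le hM
  have ht := (Matrix.nonneg_iff_posSemidef.1 hX).trace_nonneg
  refine ⟨X.trace / b, by positivity, (le_trace_smul_one hX).trans ?_⟩
  have := smul_le_smul_of_nonneg_left h (by positivity : 0 ≤ X.trace / b)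
  rwa [smul_smul, div_mul_cancel₀ _ hb.ne'] at this

/-- Young's inequality for congruences. -/
theorem sub_conj_le {k l : ℕ} {X : Matrix (Fin k) (Fin k) ℝ} (hX : 0 ≤ X)
    (U V : Matrix (Fin l) (Fin k) ℝ) {a : ℝ} (ha : 0 < a) :
    (U - V) * X * (U - V)ᵀ ≤ (1 + a) • (U * X * Uᵀ) + (1 + 1 / a) • (V * X * Vᵀ) := by
  -- The right side minus the left side is `(1 / a) (a U + V) X (a U + V)'`.
  have h := smul_nonneg (by positivity : 0 ≤ 1 / a) (conj_nonneg hX (a • U + V))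
  rw [← sub_nonneg]
  refine h.trans (le_of_eq ?_)
  simp only [Matrix.transpose_sub, Matrix.transpose_add, Matrix.transpose_smul, Matrix.mul_add,
    Matrix.add_mul, Matrix.mul_sub, Matrix.sub_mul, Matrix.smul_mul, Matrix.mul_smul, smul_add,
    smul_smul, add_smul, one_smul]
  have h1 : 1 / a * (a * a) = a := by field_simp
  have h2 : 1 / a * a = 1 := by field_simp
  rw [h1, h2]
  simp only [one_smul]
  abel

variable {n m : ℕ}

theorem dropMat_mul_self (i : Mode m) : dropMat i * dropMat i = dropMat i := by
  simp only [dropMat, Matrix.diagonal_mul_diagonal]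
  congr 1
  funext l
  split <;> simp

theorem dropMat_transpose (i : Mode m) : (dropMat i)ᵀ = dropMat i := by
  simp [dropMat]

/-- The covariance `Q + L_i D_i R D_i L_i'` of the noise entering the error dynamics in mode `i`. -/
noncomputable def noiseMat (Q : Matrix (Fin n) (Fin n) ℝ) (R : Matrix (Fin m) (Fin m) ℝ)
    (L : Mode m → Matrix (Fin n) (Fin m) ℝ) (i : Mode m) : Matrix (Fin n) (Fin n) ℝ :=
  Q + (L i * dropMat i) * R * (L i * dropMat i)ᵀ

/-- The matrix `A - L_i H_i` of the error dynamics. -/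
def errMat (A : Matrix (Fin n) (Fin n) ℝ) (C : Matrix (Fin m) (Fin n) ℝ)
    (L : Mode m → Matrix (Fin n) (Fin m) ℝ) (i : Mode m) : Matrix (Fin n) (Fin n) ℝ :=
  A - L i * obsMat C i

/-- `D_i` is idempotent and already a factor of `H_i`, so the gain acts on both the error and the
noise only through `L_i D_i`. -/
theorem mul_obsMat_eq (C : Matrix (Fin m) (Fin n) ℝ) (L : Mode m → Matrix (Fin n) (Fin m) ℝ)
    (i : Mode m) : L i * obsMat C i = L i * dropMat i * obsMat C i := by
  rw [obsMat, Matrix.mul_assoc, ← Matrix.mul_assoc (dropMat i), dropMat_mul_self]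

/-- The operator of the error dynamics with gains `L`. -/
noncomputable abbrev errOp (A : Matrix (Fin n) (Fin n) ℝ) (C : Matrix (Fin m) (Fin n) ℝ)
    (p q : Fin m → ℝ) (L : Mode m → Matrix (Fin n) (Fin m) ℝ) :
    (Mode m → Matrix (Fin n) (Fin n) ℝ) →ₗ[ℝ] (Mode m → Matrix (Fin n) (Fin n) ℝ) :=
  gainOp A C p q (fun i => -L i)

/-- One step of the mode chain applied to a family of matrices. -/
noncomputable def mix (p q : Fin m → ℝ) (X : Mode m → Matrix (Fin n) (Fin n) ℝ) (j : Mode m) :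
    Matrix (Fin n) (Fin n) ℝ :=
  ∑ i, modeTPM p q i j • X i

theorem errOp_apply (A : Matrix (Fin n) (Fin n) ℝ) (C : Matrix (Fin m) (Fin n) ℝ)
    (p q : Fin m → ℝ) (L : Mode m → Matrix (Fin n) (Fin m) ℝ)
    (V : Mode m → Matrix (Fin n) (Fin n) ℝ) :
    errOp A C p q L V = mix p q fun i => errMat A C L i * V i * (errMat A C L i)ᵀ := by
  funext j
  simp only [gainOp, LinearMap.coe_mk, AddHom.coe_mk, mix, errMat, Matrix.neg_mul, sub_eq_add_neg]

theorem mix_add (p q : Fin m → ℝ) (X Z : Mode m → Matrix (Fin n) (Fin n) ℝ) :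
    mix p q (X + Z) = mix p q X + mix p q Z := by
  funext j
  simp [mix, Finset.sum_add_distrib]

theorem mix_smul (p q : Fin m → ℝ) (c : ℝ) (X : Mode m → Matrix (Fin n) (Fin n) ℝ) :
    mix p q (c • X) = c • mix p q X := by
  funext j
  simp only [mix, Pi.smul_apply, Finset.smul_sum]
  exact Finset.sum_congr rfl fun i _ => smul_comm _ _ _

/-! ### Transition and stationary probabilities of the modes -/

section Probabilities

/-- A sum over all arrival patterns of a product over channels factors into one two-term sum per
channel. The total mass and the stationarity of `modeProb` follow in the same way. -/
theorem sum_modeTPM (p q : Fin m → ℝ) (i : Mode m) : ∑ j, modeTPM p q i j = 1 := by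
  have h := Finset.prod_univ_sum (fun _ : Fin m => (Finset.univ : Finset Bool))
    (fun l b => tpm (p l) (q l) (i l) b)
  rw [Fintype.piFinset_univ] at h
  refine h.symm.trans (Finset.prod_eq_one fun l _ => ?_)
  rw [Fintype.sum_bool]
  cases i l <;> simp [tpm]

variable {p q : Fin m → ℝ} (hp : ∀ i, 0 < p i ∧ p i < 1) (hq : ∀ i, 0 < q i ∧ q i < 1)
include hp hq

theorem tpm_pos (l : Fin m) (a b : Bool) : 0 < tpm (p l) (q l) a b := by
  have := hp l
  have := hq l
  cases a <;> cases b <;> simp only [tpm] <;> linarith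

theorem modeTPM_pos (i j : Mode m) : 0 < modeTPM p q i j :=
  Finset.prod_pos fun l _ => tpm_pos hp hq l _ _

theorem modeProb_pos (i : Mode m) : 0 < modeProb p q i := by
  refine Finset.prod_pos fun l _ => ?_
  have := (hp l).1
  have := (hq l).1
  cases i l <;> simp only [limitProb] <;> positivity

theorem mix_mono {X Z : Mode m → Matrix (Fin n) (Fin n) ℝ} (h : X ≤ Z) :
    mix p q X ≤ mix p q Z := fun j =>
  Finset.sum_le_sum fun i _ => smul_le_smul_of_nonneg_left (h i) (modeTPM_pos hp hq i j).le

theorem mix_nonneg {X : Mode m → Matrix (Fin n) (Fin n) ℝ} (h : 0 ≤ X) : 0 ≤ mix p q X := fun j =>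
  Finset.sum_nonneg fun i _ => smul_nonneg (modeTPM_pos hp hq i j).le (h i)

theorem errOp_nonneg (A : Matrix (Fin n) (Fin n) ℝ) (C : Matrix (Fin m) (Fin n) ℝ)
    (L : Mode m → Matrix (Fin n) (Fin m) ℝ) (V : Mode m → Matrix (Fin n) (Fin n) ℝ) (hV : 0 ≤ V) :
    0 ≤ errOp A C p q L V := by
  rw [errOp_apply]
  exact mix_nonneg hp hq fun i => conj_nonneg (hV i) _

theorem sum_modeProb : ∑ j, modeProb p q j = 1 := by
  have h := Finset.prod_univ_sum (fun _ : Fin m => (Finset.univ : Finset Bool))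
    (fun l b => limitProb (p l) (q l) b)
  rw [Fintype.piFinset_univ] at h
  refine h.symm.trans (Finset.prod_eq_one fun l _ => ?_)
  have := (hp l).1
  have := (hq l).1
  rw [Fintype.sum_bool]
  simp only [limitProb]
  field_simp
  ring

theorem modeProb_stationary (j : Mode m) :
    ∑ i, modeTPM p q i j * modeProb p q i = modeProb p q j := by
  have h := Finset.prod_univ_sum (fun _ : Fin m => (Finset.univ : Finset Bool))
    (fun l b => tpm (p l) (q l) b (j l) * limitProb (p l) (q l) b)
  rw [Fintype.piFinset_univ] at h
  simp only [modeTPM, modeProb, ← Finset.prod_mul_distrib]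
  refine h.symm.trans (Finset.prod_congr rfl fun l _ => ?_)
  have := (hp l).1
  have := (hq l).1
  rw [Fintype.sum_bool]
  cases j l <;> simp only [limitProb, tpm] <;> field_simp <;> ring

end Probabilities

/-! ### Completion of squares in the Riccati equations -/

section Riccati

variable {A : Matrix (Fin n) (Fin n) ℝ} {C : Matrix (Fin m) (Fin n) ℝ}
  {Q : Matrix (Fin n) (Fin n) ℝ} {R : Matrix (Fin m) (Fin m) ℝ} {p q : Fin m → ℝ}
  {Y : Mode m → Matrix (Fin n) (Fin n) ℝ}

/-- The excess of one Riccati step when the gains `L` replace the Kalman gains. -/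
noncomputable def excess (A : Matrix (Fin n) (Fin n) ℝ) (C : Matrix (Fin m) (Fin n) ℝ)
    (R : Matrix (Fin m) (Fin m) ℝ) (p q : Fin m → ℝ) (Y : Mode m → Matrix (Fin n) (Fin n) ℝ)
    (L : Mode m → Matrix (Fin n) (Fin m) ℝ) (i : Mode m) : Matrix (Fin n) (Fin n) ℝ :=
  (L i * dropMat i - kalmanGain A C R p q Y i) * innovMat C R p q Y i *
    (L i * dropMat i - kalmanGain A C R p q Y i)ᵀ

theorem innovMat_posDef (hR : R.PosDef) (hp : ∀ i, 0 < p i ∧ p i < 1)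
    (hq : ∀ i, 0 < q i ∧ q i < 1) (hY : ∀ i, (Y i).PosSemidef) (i : Mode m) :
    (innovMat C R p q Y i).PosDef := by
  have h1 := conj_nonneg (hY i).nonneg (obsMat C i)
  exact Matrix.PosDef.posSemidef_add (Matrix.nonneg_iff_posSemidef.1 h1)
    (hR.smul (modeProb_pos hp hq i))

/-- Completion of squares in one Riccati step. -/
theorem riccati_completion (hR : R.PosDef) (hp : ∀ i, 0 < p i ∧ p i < 1)
    (hq : ∀ i, 0 < q i ∧ q i < 1) (hY : ∀ i, (Y i).PosSemidef)
    (L : Mode m → Matrix (Fin n) (Fin m) ℝ) (i : Mode m) :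
    errMat A C L i * Y i * (errMat A C L i)ᵀ + modeProb p q i • noiseMat Q R L i =
      (A * Y i * Aᵀ
        - A * Y i * (obsMat C i)ᵀ * (innovMat C R p q Y i)⁻¹ * obsMat C i * Y i * Aᵀ
        + modeProb p q i • Q) + excess A C R p q Y L i := by
  have hM := innovMat_posDef (C := C) hR hp hq hY i
  have hMs : (innovMat C R p q Y i)ᵀ = innovMat C R p q Y i := by
    rw [← Matrix.conjTranspose_eq_transpose_of_trivial]; exact hM.isHermitian
  have hYs : (Y i)ᵀ = Y i := by
    rw [← Matrix.conjTranspose_eq_transpose_of_trivial]; exact (hY i).isHermitian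
  have hu : IsUnit (innovMat C R p q Y i).det := hM.det_pos.ne'.isUnit
  have hKM : kalmanGain A C R p q Y i * innovMat C R p q Y i = A * Y i * (obsMat C i)ᵀ := by
    rw [kalmanGain, Matrix.mul_assoc, Matrix.nonsing_inv_mul _ hu, Matrix.mul_one]
  have hMK : innovMat C R p q Y i * (kalmanGain A C R p q Y i)ᵀ = obsMat C i * Y i * Aᵀ := by
    have := congrArg Matrix.transpose hKM
    simpa only [Matrix.transpose_mul, Matrix.transpose_transpose, hMs, hYs, Matrix.mul_assoc]
      using this
  have hKMK : kalmanGain A C R p q Y i * innovMat C R p q Y i * (kalmanGain A C R p q Y i)ᵀ =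
      A * Y i * (obsMat C i)ᵀ * (innovMat C R p q Y i)⁻¹ * obsMat C i * Y i * Aᵀ := by
    rw [Matrix.mul_assoc, hMK, kalmanGain]
    simp only [Matrix.mul_assoc]
  rw [excess, errMat, mul_obsMat_eq, noiseMat]
  set U := L i * dropMat i
  have h1 : (U - kalmanGain A C R p q Y i) * innovMat C R p q Y i *
      (U - kalmanGain A C R p q Y i)ᵀ = U * innovMat C R p q Y i * Uᵀ
        - A * Y i * (obsMat C i)ᵀ * Uᵀ - U * (obsMat C i * Y i * Aᵀ)
        + A * Y i * (obsMat C i)ᵀ * (innovMat C R p q Y i)⁻¹ * obsMat C i * Y i * Aᵀ := by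
    rw [← hKMK, ← hMK, ← hKM]
    simp only [Matrix.transpose_sub, Matrix.mul_sub, Matrix.sub_mul, Matrix.mul_assoc]
    abel
  rw [h1, innovMat]
  simp only [Matrix.transpose_sub, Matrix.transpose_mul, Matrix.mul_sub, Matrix.sub_mul,
    Matrix.mul_add, Matrix.add_mul, Matrix.mul_assoc, smul_add, Matrix.mul_smul, Matrix.smul_mul]
  abel

/-- By the CAREs, the Riccati part of the completed square averages back to `Y`; only the excess of
`L` remains. Thus every choice of gains sees `Y` as a solution of its own covariance equation, up to
a nonnegative term. -/
theorem care_completion (hR : R.PosDef) (hp : ∀ i, 0 < p i ∧ p i < 1)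
    (hq : ∀ i, 0 < q i ∧ q i < 1) (hY : IsMSStabilizingSolution A C Q R p q Y)
    (L : Mode m → Matrix (Fin n) (Fin m) ℝ) :
    Y + mix p q (excess A C R p q Y L) =
      errOp A C p q L Y + mix p q (fun i => modeProb p q i • noiseMat Q R L i) := by
  rw [errOp_apply, ← mix_add]
  have hcare : Y = mix p q (fun i => (A * Y i * Aᵀ
        - A * Y i * (obsMat C i)ᵀ * (innovMat C R p q Y i)⁻¹ * obsMat C i * Y i * Aᵀ
        + modeProb p q i • Q)) := funext hY.care
  conv_lhs => lhs; rw [hcare]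
  rw [← mix_add]
  congr 1
  funext i
  exact (riccati_completion hR hp hq hY.posSemidef L i).symm

/-- The Kalman gains ignore the dropped measurements. -/
theorem kalmanGain_mul_dropMat (hRdiag : R.IsDiag) (hR : R.PosDef)
    (hp : ∀ i, 0 < p i ∧ p i < 1) (hq : ∀ i, 0 < q i ∧ q i < 1) (hY : ∀ i, (Y i).PosSemidef)
    (i : Mode m) :
    kalmanGain A C R p q Y i * dropMat i = kalmanGain A C R p q Y i := by
  have hM := innovMat_posDef (C := C) hR hp hq hY i
  have hu : IsUnit (innovMat C R p q Y i).det := hM.det_pos.ne'.isUnit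
  -- The only use of the diagonality of `R`: it makes `D_i` commute with `R`, hence with the
  -- innovation matrix and its inverse.
  have hRD : dropMat i * R = R * dropMat i := by
    rw [← hRdiag.diagonal_diag, dropMat, Matrix.diagonal_mul_diagonal,
      Matrix.diagonal_mul_diagonal]
    simp only [mul_comm]
  have hHD : (obsMat C i)ᵀ * dropMat i = (obsMat C i)ᵀ := by
    rw [obsMat, Matrix.transpose_mul, dropMat_transpose, Matrix.mul_assoc, dropMat_mul_self]
  have hDH : dropMat i * obsMat C i = obsMat C i := by
    rw [obsMat, ← Matrix.mul_assoc, dropMat_mul_self]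
  have hcomm : dropMat i * innovMat C R p q Y i = innovMat C R p q Y i * dropMat i := by
    rw [innovMat, Matrix.mul_add, Matrix.add_mul, Matrix.mul_smul, Matrix.smul_mul, hRD,
      Matrix.mul_assoc _ _ (dropMat i), hHD, ← Matrix.mul_assoc, ← Matrix.mul_assoc, hDH]
  have hinv : (innovMat C R p q Y i)⁻¹ * dropMat i = dropMat i * (innovMat C R p q Y i)⁻¹ := by
    have h1 : (innovMat C R p q Y i)⁻¹ * (dropMat i * innovMat C R p q Y i) *
        (innovMat C R p q Y i)⁻¹ = (innovMat C R p q Y i)⁻¹ * (innovMat C R p q Y i * dropMat i) *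
        (innovMat C R p q Y i)⁻¹ := by rw [hcomm]
    rwa [← Matrix.mul_assoc, Matrix.mul_assoc _ _ (innovMat C R p q Y i)⁻¹,
      Matrix.mul_nonsing_inv _ hu, Matrix.mul_one, ← Matrix.mul_assoc,
      Matrix.nonsing_inv_mul _ hu, Matrix.one_mul] at h1
  rw [kalmanGain, Matrix.mul_assoc, hinv, ← Matrix.mul_assoc, Matrix.mul_assoc _ _ (dropMat i),
    hHD]

theorem excess_kalmanGain (hRdiag : R.IsDiag) (hR : R.PosDef)
    (hp : ∀ i, 0 < p i ∧ p i < 1) (hq : ∀ i, 0 < q i ∧ q i < 1) (hY : ∀ i, (Y i).PosSemidef) :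
    mix p q (excess A C R p q Y (kalmanGain A C R p q Y)) = 0 := by
  funext j
  simp [mix, excess, kalmanGain_mul_dropMat hRdiag hR hp hq hY]

end Riccati

end Loewner

/-! ### Total trace and convergence of the mode law -/

section Asymptotics

open scoped MatrixOrder

variable {n m : ℕ}

/-- The sum of the traces of a family of matrices. -/
noncomputable def totalTrace (n m : ℕ) : (Mode m → Matrix (Fin n) (Fin n) ℝ) →ₗ[ℝ] ℝ :=
  ∑ i, Matrix.traceLinearMap (Fin n) ℝ ℝ ∘ₗ LinearMap.proj i

theorem totalTrace_apply (X : Mode m → Matrix (Fin n) (Fin n) ℝ) :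
    totalTrace n m X = ∑ i, (X i).trace := by
  simp [totalTrace]

theorem totalTrace_nonneg (X : Mode m → Matrix (Fin n) (Fin n) ℝ) (hX : 0 ≤ X) :
    0 ≤ totalTrace n m X := by
  rw [totalTrace_apply]
  exact Finset.sum_nonneg fun i _ => (Matrix.nonneg_iff_posSemidef.1 (hX i)).trace_nonneg

theorem one_nonneg_family : (0 : Mode m → Matrix (Fin n) (Fin n) ℝ) ≤ 1 := fun _ =>
  Matrix.PosSemidef.one.nonneg

theorem le_totalTrace_smul_one (X : Mode m → Matrix (Fin n) (Fin n) ℝ) (hX : 0 ≤ X) :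
    X ≤ totalTrace n m X • 1 := fun i => by
  refine (le_trace_smul_one (hX i)).trans ?_
  rw [Pi.smul_apply, Pi.one_apply, ← sub_nonneg, ← sub_smul]
  refine smul_nonneg (sub_nonneg.2 ?_) Matrix.PosSemidef.one.nonneg
  rw [totalTrace_apply]
  exact Finset.single_le_sum (f := fun j => (X j).trace)
    (fun j _ => (Matrix.nonneg_iff_posSemidef.1 (hX j)).trace_nonneg) (Finset.mem_univ i)

theorem chain_sum {p q : Fin m → ℝ} {π : ℕ → Mode m → ℝ}
    (hπ : ∀ k j, π (k + 1) j = ∑ i, modeTPM p q i j * π k i) (hπ1 : ∑ j, π 0 j = 1) (k : ℕ) :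
    ∑ j, π k j = 1 := by
  induction k with
  | zero => exact hπ1
  | succ k ih =>
    simp only [hπ]
    rw [Finset.sum_comm]
    simp only [← Finset.sum_mul, sum_modeTPM, one_mul, ih]

variable {p q : Fin m → ℝ} (hp : ∀ i, 0 < p i ∧ p i < 1) (hq : ∀ i, 0 < q i ∧ q i < 1)
  {π : ℕ → Mode m → ℝ} (hπ : ∀ k j, π (k + 1) j = ∑ i, modeTPM p q i j * π k i)
  (hπ0 : ∀ j, 0 ≤ π 0 j) (hπ1 : ∑ j, π 0 j = 1)
include hp hq hπ hπ0

theorem chain_nonneg (k : ℕ) (j : Mode m) : 0 ≤ π k j := by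
  induction k generalizing j with
  | zero => exact hπ0 j
  | succ k ih =>
    rw [hπ]
    exact Finset.sum_nonneg fun i _ => mul_nonneg (modeTPM_pos hp hq i j).le (ih i)

include hπ1

/-- Doeblin minorization for the mode chain. -/
theorem exists_minorization : ∃ ε : ℝ, 0 < ε ∧ ε ≤ 1 ∧
    ∀ k j, (1 - (1 - ε) ^ k) * modeProb p q j ≤ π k j := by
  obtain ⟨x, -, hx⟩ := Finset.exists_min_image (Finset.univ : Finset (Mode m × Mode m))
    (fun x => modeTPM p q x.1 x.2) Finset.univ_nonempty
  have hμ1 : ∀ j, modeProb p q j ≤ 1 := fun j => by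
    rw [← sum_modeProb hp hq]
    exact Finset.single_le_sum (f := modeProb p q) (fun i _ => (modeProb_pos hp hq i).le)
      (Finset.mem_univ j)
  refine ⟨modeTPM p q x.1 x.2, modeTPM_pos hp hq _ _, ?_, ?_⟩
  · rw [← sum_modeTPM p q x.1]
    exact Finset.single_le_sum (f := fun j => modeTPM p q x.1 j)
      (fun i _ => (modeTPM_pos hp hq _ i).le) (Finset.mem_univ x.2)
  · have hε := modeTPM_pos hp hq x.1 x.2
    set ε := modeTPM p q x.1 x.2
    intro k
    induction k with
    | zero => intro j; simpa using hπ0 j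
    | succ k ih =>
      intro j
      set c := 1 - (1 - ε) ^ k with hc
      -- The remainder `π k - c μ` is nonnegative of mass `1 - c`. Every transition probability is
      -- at least `ε ≥ ε μ_j`, so one step adds `ε (1 - c) μ_j` to the minorant; this turns `1 - c`
      -- into `(1 - ε) (1 - c)`.
      have h1 : ∑ i, ε * modeProb p q j * (π k i - c * modeProb p q i) ≤
          ∑ i, modeTPM p q i j * (π k i - c * modeProb p q i) := by
        refine Finset.sum_le_sum fun i _ => mul_le_mul_of_nonneg_right ?_ (sub_nonneg.2 (ih i))
        calc ε * modeProb p q j ≤ ε * 1 := mul_le_mul_of_nonneg_left (hμ1 j) hε.le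
          _ ≤ modeTPM p q i j := by rw [mul_one]; exact hx (i, j) (Finset.mem_univ _)
      rw [← Finset.mul_sum, Finset.sum_sub_distrib, ← Finset.mul_sum, sum_modeProb hp hq,
        chain_sum hπ hπ1] at h1
      have h2 : ∑ i, modeTPM p q i j * (π k i - c * modeProb p q i) =
          π (k + 1) j - c * modeProb p q j := by
        rw [hπ, ← modeProb_stationary hp hq j, Finset.mul_sum, ← Finset.sum_sub_distrib]
        exact Finset.sum_congr rfl fun i _ => by ring
      rw [h2] at h1
      have h3 : (1 - (1 - ε) ^ (k + 1)) * modeProb p q j =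
          ε * modeProb p q j * (1 - c * 1) + c * modeProb p q j := by rw [hc]; ring
      linarith

/-- From time `1` on, the minorant is at least its value `ε μ` at time `1`. Time `0` is excluded
because the initial law may vanish at some modes. -/
theorem exists_uniform_minorization : ∃ c : ℝ, 0 < c ∧
    ∀ k j, c * modeProb p q j ≤ π (k + 1) j := by
  obtain ⟨ε, hε, hε1, h⟩ := exists_minorization hp hq hπ hπ0 hπ1
  refine ⟨ε, hε, fun k j => le_trans (mul_le_mul_of_nonneg_right ?_ (modeProb_pos hp hq j).le)
    (h (k + 1) j)⟩
  have : (1 - ε) ^ (k + 1) ≤ (1 - ε) ^ 1 :=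
    pow_le_pow_of_le_one (by linarith) (by linarith) (by omega)
  linarith

/-- The lower bound is the minorization at `j`. The upper bound is the minorization at all the other
modes, because `π k` and `μ` both have mass `1`. -/
theorem chain_tendsto (j : Mode m) : Tendsto (fun k => π k j) atTop (𝓝 (modeProb p q j)) := by
  obtain ⟨ε, hε, hε1, h⟩ := exists_minorization hp hq hπ hπ0 hπ1
  have hc : Tendsto (fun k : ℕ => 1 - (1 - ε) ^ k) atTop (𝓝 1) := by
    simpa using (tendsto_pow_atTop_nhds_zero_of_lt_one (by linarith : 0 ≤ 1 - ε)
      (by linarith)).const_sub 1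
  have hl := hc.mul_const (modeProb p q j)
  have hu : Tendsto (fun k : ℕ => 1 - (1 - (1 - ε) ^ k) * (1 - modeProb p q j)) atTop
      (𝓝 (1 - 1 * (1 - modeProb p q j))) := (hc.mul_const _).const_sub 1
  rw [one_mul] at hl hu
  rw [sub_sub_cancel] at hu
  refine tendsto_of_tendsto_of_tendsto_of_le_of_le hl hu (fun k => h k j) fun k => ?_
  have h1 := chain_sum hπ hπ1 k
  have h2 := sum_modeProb hp hq
  rw [← Finset.add_sum_erase _ _ (Finset.mem_univ j)] at h1 h2
  have h3 := Finset.sum_le_sum (s := Finset.univ.erase j) fun i _ => h k i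
  rw [← Finset.mul_sum, eq_sub_of_add_eq' h2] at h3
  linarith

theorem eventually_minorization {c : ℝ} (hc : c < 1) :
    ∀ᶠ s in atTop, ∀ k, s ≤ k → ∀ j, c * modeProb p q j ≤ π k j := by
  have h : ∀ᶠ k in atTop, ∀ j, c * modeProb p q j ≤ π k j := by
    refine eventually_all.2 fun j => (chain_tendsto hp hq hπ hπ0 hπ1 j).eventually_const_le ?_
    have := modeProb_pos hp hq j
    nlinarith
  obtain ⟨s, hs⟩ := eventually_atTop.1 h
  exact eventually_atTop.2 ⟨s, fun t ht k hk => hs k (ht.trans hk)⟩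

theorem eventually_majorization {c : ℝ} (hc : 1 < c) :
    ∀ᶠ s in atTop, ∀ k, s ≤ k → ∀ j, π k j ≤ c * modeProb p q j := by
  have h : ∀ᶠ k in atTop, ∀ j, π k j ≤ c * modeProb p q j := by
    refine eventually_all.2 fun j => (chain_tendsto hp hq hπ hπ0 hπ1 j).eventually_le_const ?_
    have := modeProb_pos hp hq j
    nlinarith
  obtain ⟨s, hs⟩ := eventually_atTop.1 h
  exact eventually_atTop.2 ⟨s, fun t ht k hk => hs k (ht.trans hk)⟩

end Asymptotics

/-! ### Asymptotics of the error covariance recursion -/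

section Dynamics

open scoped MatrixOrder

variable {n m : ℕ} {A : Matrix (Fin n) (Fin n) ℝ} {C : Matrix (Fin m) (Fin n) ℝ}
  {Q : Matrix (Fin n) (Fin n) ℝ} {R : Matrix (Fin m) (Fin m) ℝ} {p q : Fin m → ℝ}
  {Y : Mode m → Matrix (Fin n) (Fin n) ℝ} {L : Mode m → Matrix (Fin n) (Fin m) ℝ}

theorem noiseMat_nonneg (hQ : Q.PosSemidef) (hR : R.PosDef) (i : Mode m) :
    0 ≤ noiseMat Q R L i :=
  add_nonneg hQ.nonneg (conj_nonneg hR.posSemidef.nonneg _)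

theorem excess_nonneg (hR : R.PosDef) (hp : ∀ i, 0 < p i ∧ p i < 1)
    (hq : ∀ i, 0 < q i ∧ q i < 1) (hY : ∀ i, (Y i).PosSemidef) :
    0 ≤ mix p q (excess A C R p q Y L) :=
  mix_nonneg hp hq fun i => conj_nonneg (innovMat_posDef hR hp hq hY i).posSemidef.nonneg _

/-- Testing on the identity family suffices: every nonnegative family is bounded by a multiple of
it, and the operator is positive. -/
theorem tendsto_of_isMSStable (hp : ∀ i, 0 < p i ∧ p i < 1) (hq : ∀ i, 0 < q i ∧ q i < 1)
    (hL : IsMSStable A C p q L) :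
    Tendsto (fun t : ℕ => totalTrace n m ((errOp A C p q L ^ t) 1)) atTop (𝓝 0) := by
  obtain ⟨r, hr, h⟩ := exists_rate _ hL
  have hnn : ∀ t : ℕ, 0 ≤ totalTrace n m ((errOp A C p q L ^ t) 1) := fun t =>
    totalTrace_nonneg _ (pow_apply_nonneg (errOp_nonneg hp hq A C L) t one_nonneg_family)
  exact squeeze_zero hnn (fun t => le_mul_of_one_le_left (hnn t) (one_le_pow₀ hr.le))
    (h (totalTrace n m) 1)

/-- Gains whose accumulated excess over the Kalman gains is bounded have vanishing homogeneous
error dynamics. -/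
theorem tendsto_of_bounded_excess (hR : R.PosDef) (hp : ∀ i, 0 < p i ∧ p i < 1)
    (hq : ∀ i, 0 < q i ∧ q i < 1) (hY : IsMSStabilizingSolution A C Q R p q Y) {b : ℝ}
    (hb : ∀ k, ∑ t ∈ Finset.range k,
      totalTrace n m ((errOp A C p q L ^ t) (mix p q (excess A C R p q Y L))) ≤ b) :
    Tendsto (fun t : ℕ => totalTrace n m ((errOp A C p q L ^ t) 1)) atTop (𝓝 0) := by
  obtain ⟨r, hr, h⟩ := exists_rate _ hY.stable
  obtain ⟨P, hP, hlyap⟩ := exists_lyapunov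
    (errOp_nonneg hp hq A C (kalmanGain A C R p q Y)) one_nonneg_family
    le_totalTrace_smul_one hr (h (totalTrace n m) 1)
  -- The innovation matrices are positive definite, so they absorb `H_i P_i H_i'`; this is what lets
  -- the excess control the perturbation of the Lyapunov family.
  choose c hc hcM using fun i => exists_le_smul_posDef (conj_nonneg (hP i) (obsMat C i))
    (innovMat_posDef (C := C) hR hp hq hY.posSemidef i)
  set K := kalmanGain A C R p q Y with hK
  have hr0 : 0 < r - 1 := by linarith
  have hb0 : 0 ≤ 1 + 1 / (r - 1) := by positivity
  have hcs : 0 ≤ ∑ i, c i := Finset.sum_nonneg fun i _ => hc i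
  refine tendsto_zero_of_bounded_excess (errOp_nonneg hp hq A C L) totalTrace_nonneg
    one_nonneg_family hP hlyap (c := (1 + 1 / (r - 1)) * ∑ i, c i) ?_ (by positivity) hb
  rw [errOp_apply, errOp_apply, ← mix_smul, ← mix_smul, ← mix_add]
  refine mix_mono hp hq fun i => ?_
  set D := L i * dropMat i - K i
  have hF : errMat A C L i = errMat A C K i - D * obsMat C i := by
    simp only [errMat, D]
    rw [mul_obsMat_eq C L, Matrix.sub_mul]
    abel
  have hM0 : 0 ≤ innovMat C R p q Y i :=
    (innovMat_posDef hR hp hq hY.posSemidef i).posSemidef.nonneg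
  have h1 : D * obsMat C i * P i * (D * obsMat C i)ᵀ ≤
      (∑ i, c i) • (D * innovMat C R p q Y i * Dᵀ) := by
    have h2 : obsMat C i * P i * (obsMat C i)ᵀ ≤ (∑ i, c i) • innovMat C R p q Y i := by
      refine (hcM i).trans ?_
      rw [← sub_nonneg, ← sub_smul]
      exact smul_nonneg (sub_nonneg.2 (Finset.single_le_sum (f := c) (fun j _ => hc j)
        (Finset.mem_univ i))) hM0
    have h3 := conj_mono h2 D
    simpa only [Matrix.transpose_mul, Matrix.mul_assoc, Matrix.mul_smul, Matrix.smul_mul] using h3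
  -- Young's inequality with parameter `r - 1`: the factor `1 + (r - 1) = r` on the Kalman part is
  -- exactly the margin in the Lyapunov inequality.
  have h4 := sub_conj_le (hP i) (errMat A C K i) (D * obsMat C i) hr0
  rw [hF]
  refine h4.trans ?_
  simp only [Pi.add_apply, Pi.smul_apply]
  rw [add_sub_cancel, mul_smul]
  exact add_le_add_right (smul_le_smul_of_nonneg_left h1 hb0) _

theorem mix_smul_noise_mono (hQ : Q.PosSemidef) (hR : R.PosDef) (hp : ∀ i, 0 < p i ∧ p i < 1)
    (hq : ∀ i, 0 < q i ∧ q i < 1) {a b : Mode m → ℝ} (h : ∀ i, a i ≤ b i) :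
    mix p q (fun i => a i • noiseMat Q R L i) ≤ mix p q (fun i => b i • noiseMat Q R L i) :=
  mix_mono hp hq fun i => by
    rw [← sub_nonneg, ← sub_smul]
    exact smul_nonneg (sub_nonneg.2 (h i)) (noiseMat_nonneg hQ hR i)

theorem mix_const_smul_noise (c : ℝ) (a : Mode m → ℝ) :
    mix p q (fun i => (c * a i) • noiseMat Q R L i) =
      c • mix p q (fun i => a i • noiseMat Q R L i) := by
  rw [← mix_smul]
  congr 1
  funext i
  simp [mul_smul]

/-- `X` is the sequence of error covariances restricted to the modes, for the gains `L`, the mode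
probabilities `π` and the initial error second moment `S`. -/
structure IsErrorCovariance (A : Matrix (Fin n) (Fin n) ℝ) (C : Matrix (Fin m) (Fin n) ℝ)
    (Q : Matrix (Fin n) (Fin n) ℝ) (R : Matrix (Fin m) (Fin m) ℝ) (p q : Fin m → ℝ)
    (L : Mode m → Matrix (Fin n) (Fin m) ℝ) (π : ℕ → Mode m → ℝ) (S : Matrix (Fin n) (Fin n) ℝ)
    (X : ℕ → Mode m → Matrix (Fin n) (Fin n) ℝ) : Prop where
  chain : ∀ k j, π (k + 1) j = ∑ i, modeTPM p q i j * π k i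
  nonneg : ∀ j, 0 ≤ π 0 j
  total : ∑ j, π 0 j = 1
  init_nonneg : 0 ≤ S
  init : X 0 = fun j => π 0 j • S
  step : ∀ k, X (k + 1) = errOp A C p q L (X k) + mix p q (fun i => π k i • noiseMat Q R L i)

variable {π : ℕ → Mode m → ℝ} {S : Matrix (Fin n) (Fin n) ℝ}
  {X : ℕ → Mode m → Matrix (Fin n) (Fin n) ℝ}

namespace IsErrorCovariance

variable (hX : IsErrorCovariance A C Q R p q L π S X) (hQ : Q.PosSemidef) (hR : R.PosDef)
  (hp : ∀ i, 0 < p i ∧ p i < 1) (hq : ∀ i, 0 < q i ∧ q i < 1)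
include hX hQ hR hp hq

theorem covariance_nonneg (k : ℕ) : 0 ≤ X k := by
  induction k with
  | zero =>
    rw [hX.init]
    exact fun j => smul_nonneg (hX.nonneg j) hX.init_nonneg
  | succ k ih =>
    rw [hX.step]
    exact add_nonneg (errOp_nonneg hp hq A C L _ ih) (mix_nonneg hp hq fun i =>
      smul_nonneg (chain_nonneg hp hq hX.chain hX.nonneg k i) (noiseMat_nonneg hQ hR i))

/-- Once `π k ≥ c μ`, the orbit bound gives `c (Y - T^t Y)`, and `T^t Y` vanishes. Only the decay
`hφ` is assumed, not stability, so that the bounded-excess case for arbitrary gains is covered too.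
-/
theorem eventually_lower_bound (hY : IsMSStabilizingSolution A C Q R p q Y)
    (hφ : Tendsto (fun t : ℕ => totalTrace n m ((errOp A C p q L ^ t) 1)) atTop (𝓝 0))
    {r : ℝ} (hr : r < totalTrace n m Y) : ∀ᶠ k in atTop, r ≤ totalTrace n m (X k) := by
  have hY0 : 0 ≤ Y := fun i => (hY.posSemidef i).nonneg
  have hT := errOp_nonneg hp hq A C L
  obtain ⟨c, hc0, hc1, hcr⟩ : ∃ c : ℝ, 0 < c ∧ c < 1 ∧ r < c * totalTrace n m Y := by
    have h1 : Tendsto (fun c : ℝ => c * totalTrace n m Y) (𝓝[<] 1) (𝓝 (1 * totalTrace n m Y)) :=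
      (tendsto_id.mul_const _).mono_left nhdsWithin_le_nhds
    have h2 := (h1.eventually (lt_mem_nhds (by simpa using hr))).and
      (Ioo_mem_nhdsLT (zero_lt_one' ℝ))
    obtain ⟨c, h3, h4⟩ := h2.exists
    exact ⟨c, h4.1, h4.2, h3⟩
  obtain ⟨s, hs⟩ := (eventually_minorization hp hq hX.chain hX.nonneg hX.total hc1).exists
  have hbound : ∀ t, c • (Y - (errOp A C p q L ^ t) Y) ≤ X (s + t) := by
    refine lower_orbit_bound hT (care_completion hR hp hq hY L)
      (excess_nonneg hR hp hq hY.posSemidef) (X := fun t => X (s + t)) hc0.le ?_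
      (hX.covariance_nonneg hQ hR hp hq s)
    intro k
    rw [← add_assoc, hX.step, ← mix_const_smul_noise]
    exact add_le_add_right (mix_smul_noise_mono hQ hR hp hq (hs (s + k) (by omega))) _
  have hφY : Tendsto (fun t : ℕ => totalTrace n m ((errOp A C p q L ^ t) Y)) atTop (𝓝 0) := by
    refine squeeze_zero (fun t => totalTrace_nonneg _ (pow_apply_nonneg hT t hY0)) (fun t => ?_)
      (by simpa using hφ.const_mul (totalTrace n m Y))
    have h1 := map_le_map_of_nonneg (T := totalTrace n m ∘ₗ errOp A C p q L ^ t)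
      (fun x hx => totalTrace_nonneg _ (pow_apply_nonneg hT t hx)) (le_totalTrace_smul_one Y hY0)
    simpa using h1
  have hlim : Tendsto (fun t : ℕ => c * (totalTrace n m Y -
      totalTrace n m ((errOp A C p q L ^ t) Y))) atTop (𝓝 (c * (totalTrace n m Y - 0))) :=
    (hφY.const_sub _).const_mul c
  rw [sub_zero] at hlim
  obtain ⟨N, hN⟩ := eventually_atTop.1 (hlim.eventually (lt_mem_nhds hcr))
  refine eventually_atTop.2 ⟨s + N, fun k hk => ?_⟩
  obtain ⟨t, rfl⟩ := Nat.exists_eq_add_of_le (by omega : s ≤ k)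
  have h1 := map_le_map_of_nonneg totalTrace_nonneg (hbound t)
  rw [map_smul, map_sub, smul_eq_mul] at h1
  exact (hN t (by omega)).le.trans h1

/-- The upper half mirrors the lower one with `c > 1`. It needs the Kalman gains because the upper
orbit bound requires the excess to vanish. -/
theorem tendsto_optimal (hRdiag : R.IsDiag) (hY : IsMSStabilizingSolution A C Q R p q Y)
    (hL : L = kalmanGain A C R p q Y) :
    Tendsto (fun k => totalTrace n m (X k)) atTop (𝓝 (totalTrace n m Y)) := by
  have hT := errOp_nonneg hp hq A C L
  have hY0 : 0 ≤ Y := fun i => (hY.posSemidef i).nonneg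
  have hφ : Tendsto (fun t : ℕ => totalTrace n m ((errOp A C p q L ^ t) 1)) atTop (𝓝 0) :=
    tendsto_of_isMSStable hp hq (hL ▸ hY.stable)
  refine tendsto_order.2 ⟨fun a ha => ?_, fun a ha => ?_⟩
  · obtain ⟨b, hb, hb'⟩ := exists_between ha
    filter_upwards [hX.eventually_lower_bound hQ hR hp hq hY hφ hb'] with k hk
      using hb.trans_le hk
  · obtain ⟨c, hc1, hca⟩ : ∃ c : ℝ, 1 < c ∧ c * totalTrace n m Y < a := by
      have h1 : Tendsto (fun c : ℝ => c * totalTrace n m Y) (𝓝[>] 1)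
          (𝓝 (1 * totalTrace n m Y)) :=
        (tendsto_id.mul_const _).mono_left nhdsWithin_le_nhds
      have h2 := (h1.eventually (gt_mem_nhds (by simpa using ha))).and self_mem_nhdsWithin
      obtain ⟨c, h3, h4⟩ := h2.exists
      exact ⟨c, h4, h3⟩
    obtain ⟨s, hs⟩ := (eventually_majorization hp hq hX.chain hX.nonneg hX.total hc1).exists
    have hbound : ∀ t, X (s + t) ≤ c • Y + (errOp A C p q L ^ t) (X s) := by
      refine upper_orbit_bound hT (care_completion hR hp hq hY L)
        (hL ▸ excess_kalmanGain hRdiag hR hp hq hY.posSemidef) (X := fun t => X (s + t))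
        (by linarith) hY0 ?_
      intro k
      rw [← add_assoc, hX.step, ← mix_const_smul_noise]
      exact add_le_add_right (mix_smul_noise_mono hQ hR hp hq (hs (s + k) (by omega))) _
    have hXs := hX.covariance_nonneg hQ hR hp hq s
    have hφX : Tendsto (fun t : ℕ => totalTrace n m ((errOp A C p q L ^ t) (X s))) atTop
        (𝓝 0) := by
      refine squeeze_zero (fun t => totalTrace_nonneg _ (pow_apply_nonneg hT t hXs)) (fun t => ?_)
        (by simpa using hφ.const_mul (totalTrace n m (X s)))
      have h1 := map_le_map_of_nonneg (T := totalTrace n m ∘ₗ errOp A C p q L ^ t)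
        (fun x hx => totalTrace_nonneg _ (pow_apply_nonneg hT t hx))
        (le_totalTrace_smul_one (X s) hXs)
      simpa using h1
    have hlim := hφX.const_add (c * totalTrace n m Y)
    rw [add_zero] at hlim
    obtain ⟨N, hN⟩ := eventually_atTop.1 (hlim.eventually (gt_mem_nhds hca))
    refine eventually_atTop.2 ⟨s + N, fun k hk => ?_⟩
    obtain ⟨t, rfl⟩ := Nat.exists_eq_add_of_le (by omega : s ≤ k)
    have h1 := map_le_map_of_nonneg totalTrace_nonneg (hbound t)
    rw [map_add, map_smul, smul_eq_mul] at h1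
    exact h1.trans_lt (hN t (by omega))

/-- After one step from a nondegenerate initial error, the covariance dominates a multiple of the
stabilizing solution, for arbitrary gains. -/
theorem exists_smul_le_first (hY : IsMSStabilizingSolution A C Q R p q Y) (hS : S.PosDef) :
    ∃ c : ℝ, 0 < c ∧ c • Y ≤ X 1 := by
  obtain ⟨i₀, hi₀⟩ : ∃ i, 0 < π 0 i := by
    by_contra! h
    have := Finset.sum_nonpos fun i (_ : i ∈ Finset.univ) => h i
    rw [hX.total] at this
    linarith
  have hY0 : 0 ≤ Y := fun i => (hY.posSemidef i).nonneg
  -- `Y` is dominated by a multiple of `A A' + Q`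
  set W := A * 1 * Aᵀ + Q with hW
  have hW0 : 0 ≤ W := add_nonneg (conj_nonneg Matrix.PosSemidef.one.nonneg A) hQ.nonneg
  have hμ1 : ∀ j, modeProb p q j ≤ 1 := fun j => by
    rw [← sum_modeProb hp hq]
    exact Finset.single_le_sum (f := modeProb p q) (fun i _ => (modeProb_pos hp hq i).le)
      (Finset.mem_univ j)
  have hYW : Y ≤ (totalTrace n m Y + 1) • mix p q (fun _ => W) := by
    -- With zero gains the error matrix is `A` and the noise covariance is `Q`, so `Y` is bounded by
    -- the mixture of `A Y_i A' + μ_i Q`.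
    have h1 := care_completion hR hp hq hY 0
    have h2 : Y ≤ errOp A C p q 0 Y + mix p q (fun i => modeProb p q i • noiseMat Q R 0 i) :=
      h1 ▸ le_add_of_nonneg_right (excess_nonneg hR hp hq hY.posSemidef)
    refine h2.trans ?_
    rw [errOp_apply, ← mix_add, ← mix_smul]
    refine mix_mono hp hq fun i => ?_
    have hτ := totalTrace_nonneg Y hY0
    have h3 : A * Y i * Aᵀ ≤ totalTrace n m Y • (A * 1 * Aᵀ) := by
      have := conj_mono (le_totalTrace_smul_one Y hY0 i) A
      simpa only [Pi.smul_apply, Pi.one_apply, Matrix.mul_smul, Matrix.smul_mul] using this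
    have h4 : modeProb p q i • Q ≤ (1 : ℝ) • Q := by
      rw [← sub_nonneg, ← sub_smul]
      exact smul_nonneg (sub_nonneg.2 (hμ1 i)) hQ.nonneg
    simp only [Pi.add_apply, Pi.smul_apply, errMat, noiseMat, Pi.zero_apply, Matrix.zero_mul,
      sub_zero, add_zero, hW]
    refine (add_le_add h3 h4).trans ?_
    rw [← sub_nonneg]
    have h5 : (totalTrace n m Y + 1) • (A * 1 * Aᵀ + Q) -
        (totalTrace n m Y • (A * 1 * Aᵀ) + (1 : ℝ) • Q) =
        A * 1 * Aᵀ + totalTrace n m Y • Q := by module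
    rw [h5]
    exact add_nonneg (conj_nonneg Matrix.PosSemidef.one.nonneg A) (smul_nonneg hτ hQ.nonneg)
  -- the covariance generated from mode `i₀` dominates a multiple of `A A' + Q`
  set F := errMat A C L i₀ with hF
  set U := L i₀ * dropMat i₀ with hU
  set V := F * S * Fᵀ + noiseMat Q R L i₀ with hV
  obtain ⟨a, ha, haS⟩ := exists_le_smul_posDef (X := 1) Matrix.PosSemidef.one.nonneg hS
  obtain ⟨b, hb, hbR⟩ := exists_le_smul_posDef
    (conj_nonneg Matrix.PosSemidef.one.nonneg (obsMat C i₀)) hR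
  have hFS : 0 ≤ F * S * Fᵀ := conj_nonneg hS.posSemidef.nonneg F
  have hUR : 0 ≤ U * R * Uᵀ := conj_nonneg hR.posSemidef.nonneg U
  have hWV : W ≤ (2 * a + 2 * b + 1) • V := by
    -- Since `A = F + U H`, a gain that makes `F` degenerate injects measurement noise `U R U'` in
    -- the directions where `A` acts. This is why arbitrary gains are allowed.
    have h1 : A = F - (-(U * obsMat C i₀)) := by
      simp only [hF, hU, errMat]
      rw [mul_obsMat_eq C L]
      abel
    have h2 : A * 1 * Aᵀ ≤ (2 : ℝ) • (F * 1 * Fᵀ) +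
        (2 : ℝ) • (U * (obsMat C i₀ * (1 : Matrix (Fin n) (Fin n) ℝ) * (obsMat C i₀)ᵀ) * Uᵀ) := by
      have h3 := sub_conj_le (X := 1) Matrix.PosSemidef.one.nonneg F (-(U * obsMat C i₀))
        one_pos
      rw [← h1] at h3
      norm_num at h3
      simpa only [Matrix.mul_one, Matrix.transpose_mul, Matrix.mul_assoc] using h3
    have h3 : F * 1 * Fᵀ ≤ a • (F * S * Fᵀ) := by
      simpa only [Matrix.mul_smul, Matrix.smul_mul] using conj_mono haS F
    have h4 : U * (obsMat C i₀ * (1 : Matrix (Fin n) (Fin n) ℝ) * (obsMat C i₀)ᵀ) * Uᵀ ≤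
        b • (U * R * Uᵀ) := by
      simpa only [Matrix.mul_smul, Matrix.smul_mul] using conj_mono hbR U
    have h5 : W ≤ (2 : ℝ) • a • (F * S * Fᵀ) + (2 : ℝ) • b • (U * R * Uᵀ) + Q :=
      add_le_add_left (h2.trans (add_le_add (smul_le_smul_of_nonneg_left h3 zero_le_two)
        (smul_le_smul_of_nonneg_left h4 zero_le_two))) Q
    refine h5.trans ?_
    rw [← sub_nonneg]
    have h6 : (2 * a + 2 * b + 1) • V -
        ((2 : ℝ) • a • (F * S * Fᵀ) + (2 : ℝ) • b • (U * R * Uᵀ) + Q) =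
        (2 * b + 1) • (F * S * Fᵀ) + (2 * a + 1) • (U * R * Uᵀ) + (2 * a + 2 * b) • Q := by
      simp only [hV, noiseMat, ← hU]
      module
    rw [h6]
    exact add_nonneg (add_nonneg (smul_nonneg (by positivity) hFS)
      (smul_nonneg (by positivity) hUR)) (smul_nonneg (by positivity) hQ.nonneg)
  have hV0 : 0 ≤ V := add_nonneg hFS (noiseMat_nonneg hQ hR i₀)
  -- All transition probabilities are positive, so the mass starting in `i₀` reaches every mode at
  -- time `1`; at time `0` a bound by `Y` could fail at modes of probability zero.
  obtain ⟨x, -, hx⟩ := Finset.exists_min_image (Finset.univ : Finset (Mode m × Mode m))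
    (fun x => modeTPM p q x.1 x.2) Finset.univ_nonempty
  have hε := modeTPM_pos hp hq x.1 x.2
  set ε := modeTPM p q x.1 x.2
  have hX1 : ∀ j, (ε * π 0 i₀) • V ≤ X 1 j := by
    intro j
    have h1 : X 1 = mix p q fun i => π 0 i •
        (errMat A C L i * S * (errMat A C L i)ᵀ + noiseMat Q R L i) := by
      rw [hX.step 0, hX.init, errOp_apply, ← mix_add]
      congr 1
      funext i
      simp [smul_add]
    rw [h1, mix]
    have h2 := Finset.single_le_sum (f := fun i => modeTPM p q i j • π 0 i •
        (errMat A C L i * S * (errMat A C L i)ᵀ + noiseMat Q R L i)) (fun i _ =>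
      smul_nonneg (modeTPM_pos hp hq i j).le (smul_nonneg (hX.nonneg i)
        (add_nonneg (conj_nonneg hS.posSemidef.nonneg _) (noiseMat_nonneg hQ hR i))))
      (Finset.mem_univ i₀)
    refine le_trans ?_ h2
    rw [mul_smul, ← sub_nonneg, ← sub_smul]
    exact smul_nonneg (sub_nonneg.2 (hx (i₀, j) (Finset.mem_univ _))) (smul_nonneg hi₀.le hV0)
  have hmix : ∀ j, mix p q (fun _ => W) j ≤ (Fintype.card (Mode m) : ℝ) • W := by
    intro j
    rw [mix, Nat.cast_smul_eq_nsmul, Fintype.card, ← Finset.sum_const]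
    refine Finset.sum_le_sum fun i _ => ?_
    have h1 : modeTPM p q i j ≤ 1 := by
      rw [← sum_modeTPM p q i]
      exact Finset.single_le_sum (f := fun j => modeTPM p q i j)
        (fun j _ => (modeTPM_pos hp hq i j).le) (Finset.mem_univ j)
    have h2 := smul_nonneg (sub_nonneg.2 h1) hW0
    rwa [sub_smul, one_smul, sub_nonneg] at h2
  have hτ := totalTrace_nonneg Y hY0
  have hcard : (0 : ℝ) < Fintype.card (Mode m) := by exact_mod_cast Fintype.card_pos
  set d := (totalTrace n m Y + 1) * (Fintype.card (Mode m) : ℝ) * (2 * a + 2 * b + 1) with hd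
  have hd0 : 0 < d := by positivity
  have hYV : ∀ j, Y j ≤ d • V := fun j => by
    refine (hYW j).trans ?_
    rw [hd, mul_assoc, mul_smul, mul_smul]
    exact smul_le_smul_of_nonneg_left ((hmix j).trans
      (smul_le_smul_of_nonneg_left hWV hcard.le)) (by positivity)
  refine ⟨ε * π 0 i₀ / d, by positivity, fun j => ?_⟩
  refine le_trans ?_ (hX1 j)
  have h1 := smul_le_smul_of_nonneg_left (hYV j) (by positivity : 0 ≤ ε * π 0 i₀ / d)
  rwa [smul_smul, div_mul_cancel₀ _ hd0.ne'] at h1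

/-- Dichotomy on the accumulated excess: if bounded, the homogeneous dynamics decay and
`eventually_lower_bound` applies; if unbounded, a fixed multiple of it bounds the cost from below,
which then exceeds any level. -/
theorem eventually_lower_bound_of_posDef (hY : IsMSStabilizingSolution A C Q R p q Y)
    (hS : S.PosDef) {r : ℝ} (hr : r < totalTrace n m Y) :
    ∀ᶠ k in atTop, r ≤ totalTrace n m (X k) := by
  have hT := errOp_nonneg hp hq A C L
  have hY0 : 0 ≤ Y := fun i => (hY.posSemidef i).nonneg
  by_cases hbd : ∃ b : ℝ, ∀ k, ∑ t ∈ Finset.range k,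
      totalTrace n m ((errOp A C p q L ^ t) (mix p q (excess A C R p q Y L))) ≤ b
  · obtain ⟨b, hb⟩ := hbd
    exact hX.eventually_lower_bound hQ hR hp hq hY
      (tendsto_of_bounded_excess hR hp hq hY hb) hr
  · push Not at hbd
    obtain ⟨c₁, hc₁, h₁⟩ := hX.exists_smul_le_first hQ hR hp hq hY hS
    obtain ⟨c₂, hc₂, h₂⟩ := exists_uniform_minorization hp hq hX.chain hX.nonneg hX.total
    -- One constant serves both comparisons: `c Y` with the covariance at time `1`, and `c μ` with
    -- the mode law at all later times.
    set c := min c₁ c₂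
    have hc : 0 < c := lt_min hc₁ hc₂
    have hbound : ∀ t, c • (Y + ∑ s ∈ Finset.range t,
        (errOp A C p q L ^ s) (mix p q (excess A C R p q Y L))) ≤ X (1 + t) := by
      refine excess_orbit_bound hT (care_completion hR hp hq hY L) (X := fun t => X (1 + t)) ?_ ?_
      · intro k
        rw [← add_assoc, hX.step, ← mix_const_smul_noise]
        refine add_le_add_right (mix_smul_noise_mono hQ hR hp hq fun j => ?_) _
        rw [add_comm 1 k]
        exact (mul_le_mul_of_nonneg_right (min_le_right _ _) (modeProb_pos hp hq j).le).trans
          (h₂ k j)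
      · refine le_trans ?_ h₁
        rw [← sub_nonneg, ← sub_smul]
        exact smul_nonneg (sub_nonneg.2 (min_le_left _ _)) hY0
    obtain ⟨N, hN⟩ := hbd (r / c)
    refine eventually_atTop.2 ⟨1 + N, fun k hk => ?_⟩
    obtain ⟨t, rfl⟩ := Nat.exists_eq_add_of_le (by omega : 1 ≤ k)
    have h3 := map_le_map_of_nonneg totalTrace_nonneg (hbound t)
    rw [map_smul, map_add, map_sum, smul_eq_mul] at h3
    have h4 := Finset.sum_le_sum_of_subset_of_nonneg
      (Finset.range_subset_range.2 (by omega : N ≤ t)) (f := fun s =>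
        totalTrace n m ((errOp A C p q L ^ s) (mix p q (excess A C R p q Y L))))
      fun s _ _ => totalTrace_nonneg _ (pow_apply_nonneg hT s
        (excess_nonneg hR hp hq hY.posSemidef))
    have h5 := totalTrace_nonneg Y hY0
    have h6 : r < c * ∑ t ∈ Finset.range N,
      totalTrace n m ((errOp A C p q L ^ t) (mix p q (excess A C R p q Y L))) := by
      rwa [div_lt_iff₀' hc] at hN
    have h7 := mul_le_mul_of_nonneg_left h4 hc.le
    have h8 := mul_nonneg hc.le h5
    rw [mul_add] at h3
    linarith

end IsErrorCovariance

end Dynamics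

/-! ### Markov property and independent channels -/

section MarkovChains

variable {Ω S : Type*} [MeasurableSpace Ω] {P : Measure Ω} [Fintype S]
  [MeasurableSpace S] [MeasurableSingletonClass S] {θ : ℕ → Ω → S}

theorem integrable_of_dependsOn [IsFiniteMeasure P] (hθ : ∀ k, Measurable (θ k))
    {f : (ℕ → S) → ℝ} {k : ℕ} (hf : DependsOn f (Set.Iic k)) :
    Integrable (fun ω => f fun l => θ l ω) P := by
  let X : Ω → Fin (k + 1) → S := fun ω l => θ l ω
  -- Freezing the path after time `k` makes the integrand factor through the finite set of paths of
  -- length `k + 1`.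
  let ext : (Fin (k + 1) → S) → ℕ → S := fun r l => r ⟨min l k, by omega⟩
  have hX : Measurable X := measurable_pi_lambda _ fun l => hθ l
  have h : (fun ω => f fun l => θ l ω) = (fun r => f (ext r)) ∘ X := by
    funext ω
    refine hf fun l hl => ?_
    simp only [ext, X, min_eq_left (Set.mem_Iic.1 hl)]
  rw [h]
  exact (Integrable.of_finite (μ := P.map X)).comp_measurable hX

/-- The Markov property for functions of the past. -/
theorem IsMarkovChain.integral_mul_indicator [DecidableEq S] [IsFiniteMeasure P]
    (hθ : ∀ k, Measurable (θ k))
    {T : S → S → ℝ} (hT : ∀ i j, 0 ≤ T i j) (hM : IsMarkovChain P θ T)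
    {f : (ℕ → S) → ℝ} {k : ℕ} (hf : DependsOn f (Set.Iic k)) (j : S) :
    ∫ ω, f (fun l => θ l ω) * (if θ (k + 1) ω = j then 1 else 0) ∂P =
      ∫ ω, f (fun l => θ l ω) * T (θ k ω) j ∂P := by
  -- The padding value `j` is essential: it makes `B' r` the event `B r` together with `θ (k + 1) =
  -- j`, so the Markov identity applies path by path.
  let ext : (Fin (k + 1) → S) → ℕ → S := fun r l =>
    if h : l < k + 1 then r ⟨l, h⟩ else j
  let B : (Fin (k + 1) → S) → Set Ω := fun r => {ω | ∀ l ≤ k, θ l ω = ext r l}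
  let B' : (Fin (k + 1) → S) → Set Ω := fun r => {ω | ∀ l ≤ k + 1, θ l ω = ext r l}
  have hmeas : ∀ (s : ℕ) (a : ℕ → S), MeasurableSet {ω | ∀ l ≤ s, θ l ω = a l} := fun s a => by
    have : {ω | ∀ l ≤ s, θ l ω = a l} = ⋂ l, ⋂ (_ : l ≤ s), θ l ⁻¹' {a l} := by
      ext ω; simp
    rw [this]
    exact MeasurableSet.iInter fun l => MeasurableSet.iInter fun _ =>
      hθ l (measurableSet_singleton _)
  have hB : ∀ r, MeasurableSet (B r) := fun r => hmeas k (ext r)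
  have hB' : ∀ r, MeasurableSet (B' r) := fun r => hmeas (k + 1) (ext r)
  have hreal : ∀ r, P.real (B' r) = P.real (B r) * T (ext r k) j := fun r => by
    have h1 := hM k (ext r)
    have h2 : ext r (k + 1) = j := by simp [ext]
    rw [h2] at h1
    simp only [Measure.real, B, B', h1, ENNReal.toReal_mul, ENNReal.toReal_ofReal (hT _ _)]
  have hmem : ∀ ω r, ω ∈ B r ↔ r = fun l : Fin (k + 1) => θ l ω := by
    intro ω r
    constructor
    · intro h
      funext l
      have := h l (by omega)
      simp only [ext, l.2, dif_pos] at this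
      exact this.symm
    · rintro rfl l hl
      simp only [ext, dif_pos (Nat.lt_succ_of_le hl)]
  have hex : ∀ ω, ∃ r, ω ∈ B r := fun ω => ⟨fun l => θ l ω, (hmem ω _).2 rfl⟩
  have huniq : ∀ ω r r', ω ∈ B r → ω ∈ B r' → r = r' := fun ω r r' h h' =>
    ((hmem ω r).1 h).trans ((hmem ω r').1 h').symm
  have hmem' : ∀ ω r, ω ∈ B' r ↔ ω ∈ B r ∧ θ (k + 1) ω = j := by
    intro ω r
    constructor
    · intro h
      refine ⟨fun l hl => h l (by omega), ?_⟩
      have := h (k + 1) le_rfl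
      simpa [ext] using this
    · rintro ⟨h, h'⟩ l hl
      rcases Nat.lt_or_ge k l with h1 | h1
      · obtain rfl : l = k + 1 := by omega
        simpa [ext] using h'
      · exact h l h1
  have hfB : ∀ ω r, ω ∈ B r → f (fun l => θ l ω) = f (ext r) := fun ω r h => by
    refine hf fun l hl => ?_
    exact h l hl
  have hL : ∀ ω, f (fun l => θ l ω) * (if θ (k + 1) ω = j then 1 else 0) =
      ∑ r, f (ext r) * (B' r).indicator 1 ω := by
    intro ω
    obtain ⟨r₀, h1⟩ := hex ω
    rw [Finset.sum_eq_single r₀]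
    · rw [hfB ω r₀ h1]
      by_cases h2 : θ (k + 1) ω = j
      · rw [if_pos h2, Set.indicator_of_mem ((hmem' ω r₀).2 ⟨h1, h2⟩), Pi.one_apply]
      · rw [if_neg h2, Set.indicator_of_notMem fun h => h2 ((hmem' ω r₀).1 h).2]
    · intro r _ hr
      rw [Set.indicator_of_notMem fun h => hr (huniq ω r r₀ ((hmem' ω r).1 h).1 h1), mul_zero]
    · simp
  have hR : ∀ ω, f (fun l => θ l ω) * T (θ k ω) j =
      ∑ r, f (ext r) * T (ext r k) j * (B r).indicator 1 ω := by
    intro ω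
    obtain ⟨r₀, h1⟩ := hex ω
    rw [Finset.sum_eq_single r₀]
    · rw [hfB ω r₀ h1, Set.indicator_of_mem h1, ← h1 k le_rfl, Pi.one_apply, mul_one]
    · intro r _ hr
      rw [Set.indicator_of_notMem fun h => hr (huniq ω r r₀ h h1), mul_zero]
    · simp
  have hint : ∀ B : Set Ω, MeasurableSet B → Integrable (B.indicator (1 : Ω → ℝ)) P :=
    fun B hB => (integrable_const (1 : ℝ)).indicator hB
  simp only [hL, hR]
  rw [integral_finsetSum _ fun r _ => (hint _ (hB' r)).const_mul _,
    integral_finsetSum _ fun r _ => (hint _ (hB r)).const_mul _]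
  refine Finset.sum_congr rfl fun r _ => ?_
  rw [integral_const_mul, integral_const_mul, integral_indicator_one (hB' r),
    integral_indicator_one (hB r), hreal]
  ring

/-- Independent Markov chains form a Markov chain. -/
theorem isMarkovChain_pi {Ω : Type*} [MeasurableSpace Ω] {P : Measure Ω} {m : ℕ}
    {p q : Fin m → ℝ} (hp : ∀ i, 0 < p i ∧ p i < 1) (hq : ∀ i, 0 < q i ∧ q i < 1)
    {γ : Fin m → ℕ → Ω → Bool} (hind : iIndepFun (fun i ω k => γ i k ω) P)
    (hM : ∀ i, IsMarkovChain P (γ i) (tpm (p i) (q i))) :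
    IsMarkovChain P (fun k ω i => γ i k ω) (modeTPM p q) := by
  have key : ∀ (s : ℕ) (a : ℕ → Mode m), P {ω | ∀ l ≤ s, (fun i => γ i l ω) = a l} =
      ∏ i, P {ω | ∀ l ≤ s, γ i l ω = a l i} := by
    intro s a
    have h := hind.measure_inter_preimage_eq_mul Finset.univ
      (sets := fun i => {g : ℕ → Bool | ∀ l ≤ s, g l = a l i}) fun i _ => by
        have : {g : ℕ → Bool | ∀ l ≤ s, g l = a l i} =
            ⋂ l, ⋂ (_ : l ≤ s), (fun g : ℕ → Bool => g l) ⁻¹' {a l i} := by ext g; simp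
        rw [this]
        exact MeasurableSet.iInter fun l => MeasurableSet.iInter fun _ =>
          measurable_pi_apply l (measurableSet_singleton _)
    refine Eq.trans (congrArg P ?_) h
    ext ω
    simp only [Set.mem_ofPred_eq, Set.mem_iInter, Set.mem_preimage, Finset.mem_univ, funext_iff]
    exact ⟨fun h i _ l hl => h l hl i, fun h l hl i => h i trivial l hl⟩
  intro k a
  rw [key, key, modeTPM, ENNReal.ofReal_prod_of_nonneg fun i _ => (tpm_pos hp hq i _ _).le,
    ← Finset.prod_mul_distrib]
  exact Finset.prod_congr rfl fun i _ => hM i k fun l => a l i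

end MarkovChains

/-! ### Second moments of square-integrable vectors -/

section SecondMoments

variable {Ω : Type*} [MeasurableSpace Ω] {P : Measure Ω}

/-- The quadratic form at `x` is the expectation of the square of `∑ a, x a * f a`. -/
theorem posSemidef_secondMoment {n : ℕ} {f : Fin n → Ω → ℝ} (hf : ∀ a, MemLp (f a) 2 P) :
    (Matrix.of fun a b => ∫ ω, f a ω * f b ω ∂P).PosSemidef := by
  refine Matrix.PosSemidef.of_dotProduct_mulVec_nonneg ?_ fun x => ?_
  · ext a b
    simp [mul_comm]
  · have hint : ∀ a b, Integrable (fun ω => f a ω * f b ω) P := fun a b =>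
      (hf a).integrable_mul (hf b)
    have h : star x ⬝ᵥ (Matrix.of fun a b => ∫ ω, f a ω * f b ω ∂P) *ᵥ x =
        ∫ ω, (∑ a, x a * f a ω) * (∑ b, x b * f b ω) ∂P := by
      simp only [Finset.sum_mul_sum]
      rw [integral_finsetSum _ fun a _ => integrable_finsetSum _ fun b _ => by
        simpa [mul_assoc, mul_left_comm] using (hint a b).const_mul (x a * x b)]
      simp only [dotProduct, Matrix.mulVec, star_trivial, Finset.mul_sum, Matrix.of_apply]
      refine Finset.sum_congr rfl fun a _ => ?_
      rw [integral_finsetSum _ fun b _ => by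
        simpa [mul_assoc, mul_left_comm] using (hint a b).const_mul (x a * x b)]
      refine Finset.sum_congr rfl fun b _ => ?_
      rw [← integral_mul_const, ← integral_const_mul]
      exact integral_congr_ae (Eventually.of_forall fun ω => by simp only; ring)
    rw [h]
    exact integral_nonneg fun ω => mul_self_nonneg _

theorem integral_linear_combination_mul {n m : ℕ} {e w : Fin n → Ω → ℝ} {v : Fin m → Ω → ℝ}
    (he : ∀ a, MemLp (e a) 2 P) (hw : ∀ a, MemLp (w a) 2 P) (hv : ∀ a, MemLp (v a) 2 P)
    (F : Matrix (Fin n) (Fin n) ℝ) (U : Matrix (Fin n) (Fin m) ℝ) {g : Ω → ℝ} (hg : MemLp g 2 P)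
    (a : Fin n) :
    ∫ ω, (∑ c, F a c * e c ω + w a ω - ∑ d, U a d * v d ω) * g ω ∂P =
      ∑ c, F a c * ∫ ω, e c ω * g ω ∂P + ∫ ω, w a ω * g ω ∂P
        - ∑ d, U a d * ∫ ω, v d ω * g ω ∂P := by
  have h1 : ∀ c, Integrable (fun ω => F a c * (e c ω * g ω)) P := fun c =>
    ((he c).integrable_mul hg).const_mul _
  have h2 : Integrable (fun ω => w a ω * g ω) P := (hw a).integrable_mul hg
  have h3 : ∀ d, Integrable (fun ω => U a d * (v d ω * g ω)) P := fun d =>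
    ((hv d).integrable_mul hg).const_mul _
  have h4 : ∀ ω, (∑ c, F a c * e c ω + w a ω - ∑ d, U a d * v d ω) * g ω =
      ∑ c, F a c * (e c ω * g ω) + w a ω * g ω - ∑ d, U a d * (v d ω * g ω) := fun ω => by
    simp only [sub_mul, add_mul, Finset.sum_mul, mul_assoc]
  simp only [h4]
  have h5 : Integrable (fun ω => ∑ c, F a c * (e c ω * g ω)) P :=
    integrable_finsetSum _ fun c _ => h1 c
  have h6 : Integrable (fun ω => ∑ c, F a c * (e c ω * g ω) + w a ω * g ω) P := h5.add h2
  rw [integral_sub h6 (integrable_finsetSum _ fun d _ => h3 d), integral_add h5 h2,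
    integral_finsetSum _ fun c _ => h1 c, integral_finsetSum _ fun d _ => h3 d]
  simp only [integral_const_mul]

end SecondMoments

/-! ### The error along a fixed mode path -/

section ErrorProcess

variable {n m : ℕ} (A : Matrix (Fin n) (Fin n) ℝ) (C : Matrix (Fin m) (Fin n) ℝ)
  (L : Mode m → Matrix (Fin n) (Fin m) ℝ)

/-- The estimation error along a mode path `θ`, started from `e₀`. -/
def errPath (θ : ℕ → Mode m) (e₀ : Fin n → ℝ) (w : ℕ → Fin n → ℝ) (v : ℕ → Fin m → ℝ) :
    ℕ → Fin n → ℝ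
  | 0 => e₀
  | k + 1 => errMat A C L (θ k) *ᵥ errPath θ e₀ w v k + w k - (L (θ k) * dropMat (θ k)) *ᵥ v k

/-- The innovation is `D (C (x - x̂) + v)`, so the error evolves without reference to the state
itself. -/
theorem state_sub_estimate (θ : ℕ → Mode m) (x₀ z₀ : Fin n → ℝ) (w : ℕ → Fin n → ℝ)
    (v : ℕ → Fin m → ℝ) (k : ℕ) :
    state A x₀ w k - estimate A C L θ (received C θ (state A x₀ w) v) z₀ k =
      errPath A C L θ (x₀ - z₀) w v k := by
  induction k with
  | zero => rfl
  | succ k ih =>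
    simp only [state, estimate, errPath, ← ih, received, errMat, obsMat, Matrix.mulVec_sub,
      Matrix.sub_mulVec, Matrix.mulVec_add, ← Matrix.mulVec_mulVec]
    abel

/-- The second moment of the estimation error along a mode path, started from `S`. -/
noncomputable def pathCov (Q : Matrix (Fin n) (Fin n) ℝ) (R : Matrix (Fin m) (Fin m) ℝ)
    (S : Matrix (Fin n) (Fin n) ℝ) (θ : ℕ → Mode m) : ℕ → Matrix (Fin n) (Fin n) ℝ
  | 0 => S
  | k + 1 => errMat A C L (θ k) * pathCov Q R S θ k * (errMat A C L (θ k))ᵀ +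
      noiseMat Q R L (θ k)

/-- The time-`k` covariance involves the modes strictly before `k`, so at time `k + 1` it is a
function of the past up to `k`, as the Markov property requires. -/
theorem dependsOn_pathCov (Q : Matrix (Fin n) (Fin n) ℝ) (R : Matrix (Fin m) (Fin m) ℝ)
    (S : Matrix (Fin n) (Fin n) ℝ) (k : ℕ) :
    DependsOn (fun θ => pathCov A C L Q R S θ k) (Set.Iio k) := by
  induction k with
  | zero => intro θ θ' _; rfl
  | succ k ih =>
    intro θ θ' h
    have h1 : θ k = θ' k := h k (by simp)
    have h2 : pathCov A C L Q R S θ k = pathCov A C L Q R S θ' k :=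
      ih fun l hl => h l (Set.mem_Iio.2 ((Set.mem_Iio.1 hl).trans (Nat.lt_succ_self k)))
    simp only [pathCov, h1, h2]

theorem errPath_apply_succ (θ : ℕ → Mode m) (e₀ : Fin n → ℝ) (w : ℕ → Fin n → ℝ)
    (v : ℕ → Fin m → ℝ) (k : ℕ) (a : Fin n) :
    errPath A C L θ e₀ w v (k + 1) a =
      ∑ c, errMat A C L (θ k) a c * errPath A C L θ e₀ w v k c + w k a -
        ∑ d, (L (θ k) * dropMat (θ k)) a d * v k d := by
  simp only [errPath, Pi.sub_apply, Pi.add_apply, Matrix.mulVec, dotProduct]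

variable {Ω : Type*} [MeasurableSpace Ω] {P : Measure Ω}

theorem memLp_errPath (θ : ℕ → Mode m) {e₀ : Ω → Fin n → ℝ} {w : ℕ → Ω → Fin n → ℝ}
    {v : ℕ → Ω → Fin m → ℝ} (he : ∀ a, MemLp (fun ω => e₀ ω a) 2 P)
    (hw : ∀ k a, MemLp (fun ω => w k ω a) 2 P) (hv : ∀ k a, MemLp (fun ω => v k ω a) 2 P)
    (k : ℕ) (a : Fin n) :
    MemLp (fun ω => errPath A C L θ (e₀ ω) (fun k => w k ω) (fun k => v k ω) k a) 2 P := by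
  induction k generalizing a with
  | zero => exact he a
  | succ k ih =>
    simp only [errPath_apply_succ]
    exact ((memLp_finsetSum _ fun c _ => (ih c).const_mul _).add (hw k a)).sub
      (memLp_finsetSum _ fun d _ => (hv k d).const_mul _)

/-- The second moment of the error along a fixed mode path, for uncorrelated white noises. -/
theorem integral_errPath_mul (θ : ℕ → Mode m) {e₀ : Ω → Fin n → ℝ} {w : ℕ → Ω → Fin n → ℝ}
    {v : ℕ → Ω → Fin m → ℝ} {Q : Matrix (Fin n) (Fin n) ℝ} {R : Matrix (Fin m) (Fin m) ℝ}
    {S : Matrix (Fin n) (Fin n) ℝ} (he : ∀ a, MemLp (fun ω => e₀ ω a) 2 P)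
    (hw : IsWhiteNoise P w Q) (hv : IsWhiteNoise P v R)
    (hS : ∀ a b, ∫ ω, e₀ ω a * e₀ ω b ∂P = S a b)
    (hew : ∀ l a b, ∫ ω, e₀ ω a * w l ω b ∂P = 0) (hev : ∀ l a b, ∫ ω, e₀ ω a * v l ω b ∂P = 0)
    (hwv : ∀ k l a b, ∫ ω, w k ω a * v l ω b ∂P = 0) (k : ℕ) (a b : Fin n) :
    ∫ ω, errPath A C L θ (e₀ ω) (fun k => w k ω) (fun k => v k ω) k a *
      errPath A C L θ (e₀ ω) (fun k => w k ω) (fun k => v k ω) k b ∂P =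
      pathCov A C L Q R S θ k a b := by
  have hmem := memLp_errPath A C L θ he hw.memLp hv.memLp
  have hvw : ∀ k l a b, ∫ ω, v k ω a * w l ω b ∂P = 0 := fun k l a b => by
    rw [← hwv l k b a]; simp only [mul_comm]
  -- The error at time `k` is built from `e₀` and the noises before `k`, so it is uncorrelated with
  -- the noises at all times `l ≥ k`, including the present.
  have hunc : ∀ k, (∀ l ≥ k, ∀ a b, ∫ ω, errPath A C L θ (e₀ ω) (fun k => w k ω)
      (fun k => v k ω) k a * w l ω b ∂P = 0) ∧ (∀ l ≥ k, ∀ a b, ∫ ω, errPath A C L θ (e₀ ω)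
      (fun k => w k ω) (fun k => v k ω) k a * v l ω b ∂P = 0) := by
    intro k
    induction k with
    | zero => exact ⟨fun l _ => hew l, fun l _ => hev l⟩
    | succ k ih =>
      refine ⟨fun l hl a b => ?_, fun l hl a b => ?_⟩
      · simp only [errPath_apply_succ]
        rw [integral_linear_combination_mul (hmem k) (hw.memLp k) (hv.memLp k) _ _ (hw.memLp l b)]
        simp only [ih.1 l (by omega), hvw, hw.covariance, if_neg (by omega : ¬ k = l)]
        simp
      · simp only [errPath_apply_succ]
        rw [integral_linear_combination_mul (hmem k) (hw.memLp k) (hv.memLp k) _ _ (hv.memLp l b)]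
        simp only [ih.2 l (by omega), hwv, hv.covariance, if_neg (by omega : ¬ k = l)]
        simp
  induction k generalizing a b with
  | zero => exact hS a b
  | succ k ih =>
    have hswap : ∀ (f g : Ω → ℝ), ∫ ω, f ω * g ω ∂P = ∫ ω, g ω * f ω ∂P := fun f g => by
      simp only [mul_comm]
    have h1 : ∀ c, ∫ ω, errPath A C L θ (e₀ ω) (fun k => w k ω) (fun k => v k ω) k c *
        errPath A C L θ (e₀ ω) (fun k => w k ω) (fun k => v k ω) (k + 1) b ∂P =
        ∑ d, errMat A C L (θ k) b d * pathCov A C L Q R S θ k c d := by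
      intro c
      rw [hswap]
      simp only [errPath_apply_succ]
      rw [integral_linear_combination_mul (hmem k) (hw.memLp k) (hv.memLp k) _ _ (hmem k c),
        hswap, (hunc k).1 k le_rfl]
      have h2 : ∀ d, ∫ ω, v k ω d *
          errPath A C L θ (e₀ ω) (fun k => w k ω) (fun k => v k ω) k c ∂P = 0 := fun d => by
        rw [hswap, (hunc k).2 k le_rfl]
      have h3 : ∀ d, ∫ ω, errPath A C L θ (e₀ ω) (fun k => w k ω) (fun k => v k ω) k d *
          errPath A C L θ (e₀ ω) (fun k => w k ω) (fun k => v k ω) k c ∂P =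
          pathCov A C L Q R S θ k c d := fun d => by rw [hswap, ih]
      simp [h2, h3]
    have h2 : ∫ ω, w k ω a *
        errPath A C L θ (e₀ ω) (fun k => w k ω) (fun k => v k ω) (k + 1) b ∂P = Q a b := by
      rw [hswap]
      simp only [errPath_apply_succ]
      rw [integral_linear_combination_mul (hmem k) (hw.memLp k) (hv.memLp k) _ _ (hw.memLp k a),
        hswap (fun ω => w k ω b), hw.covariance]
      simp [(hunc k).1 k le_rfl, hvw]
    have h3 : ∀ d, ∫ ω, v k ω d *
        errPath A C L θ (e₀ ω) (fun k => w k ω) (fun k => v k ω) (k + 1) b ∂P =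
        - ∑ c, (L (θ k) * dropMat (θ k)) b c * R d c := by
      intro d
      rw [hswap]
      simp only [errPath_apply_succ]
      rw [integral_linear_combination_mul (hmem k) (hw.memLp k) (hv.memLp k) _ _ (hv.memLp k d)]
      have h4 : ∀ c, ∫ ω, v k ω c * v k ω d ∂P = R d c := fun c => by
        rw [hswap, hv.covariance, if_pos rfl]
      simp [(hunc k).2 k le_rfl, hwv, h4]
    have h4 : ∀ ω, errPath A C L θ (e₀ ω) (fun k => w k ω) (fun k => v k ω) (k + 1) a =
        _ := fun ω => errPath_apply_succ A C L θ _ _ _ k a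
    simp only [h4]
    rw [integral_linear_combination_mul (hmem k) (hw.memLp k) (hv.memLp k) _ _ (hmem (k + 1) b),
      h2]
    simp only [h1, h3, pathCov, noiseMat, Matrix.add_apply]
    have h5 : (errMat A C L (θ k) * pathCov A C L Q R S θ k * (errMat A C L (θ k))ᵀ) a b =
        ∑ c, errMat A C L (θ k) a c *
          ∑ d, errMat A C L (θ k) b d * pathCov A C L Q R S θ k c d := by
      rw [Matrix.mul_assoc, Matrix.mul_apply]
      simp only [Matrix.mul_apply, Matrix.transpose_apply, mul_comm]
    have h6 : (L (θ k) * dropMat (θ k) * R * (L (θ k) * dropMat (θ k))ᵀ) a b =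
        ∑ d, (L (θ k) * dropMat (θ k)) a d * ∑ c, (L (θ k) * dropMat (θ k)) b c * R d c := by
      rw [Matrix.mul_assoc _ R, Matrix.mul_apply]
      refine Finset.sum_congr rfl fun d _ => ?_
      refine congrArg _ ?_
      rw [Matrix.mul_apply]
      exact Finset.sum_congr rfl fun c _ => mul_comm _ _
    rw [h5, h6]
    simp only [mul_neg, Finset.sum_neg_distrib]
    ring

end ErrorProcess

/-! ### Averaging over the mode path -/

section ModeAverages

open scoped MatrixOrder

variable {n m : ℕ} {A : Matrix (Fin n) (Fin n) ℝ} {C : Matrix (Fin m) (Fin n) ℝ}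
  {Q : Matrix (Fin n) (Fin n) ℝ} {R : Matrix (Fin m) (Fin m) ℝ} {p q : Fin m → ℝ}
  {L : Mode m → Matrix (Fin n) (Fin m) ℝ} {S : Matrix (Fin n) (Fin n) ℝ}
  {Ω : Type*} [MeasurableSpace Ω] {P : Measure Ω} {θ : ℕ → Ω → Mode m}

theorem integral_conj_apply {k : ℕ} {M : Ω → Matrix (Fin k) (Fin k) ℝ} {g : Ω → ℝ}
    (h : ∀ c d, Integrable (fun ω => M ω c d * g ω) P) (F : Matrix (Fin k) (Fin k) ℝ)
    (a b : Fin k) :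
    ∫ ω, (F * M ω * Fᵀ) a b * g ω ∂P =
      (F * (Matrix.of fun c d => ∫ ω, M ω c d * g ω ∂P) * Fᵀ) a b := by
  have h1 : ∀ ω, (F * M ω * Fᵀ) a b * g ω =
      ∑ d, ∑ c, F a c * F b d * (M ω c d * g ω) := fun ω => by
    simp only [Matrix.mul_apply, Matrix.transpose_apply, Finset.sum_mul]
    exact Finset.sum_congr rfl fun d _ => Finset.sum_congr rfl fun c _ => by ring
  simp only [h1]
  rw [integral_finsetSum _ fun d _ => integrable_finsetSum _ fun c _ => (h c d).const_mul _]
  simp only [Matrix.mul_apply, Matrix.transpose_apply, Finset.sum_mul, Matrix.of_apply]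
  refine Finset.sum_congr rfl fun d _ => ?_
  rw [integral_finsetSum _ fun c _ => (h c d).const_mul _]
  refine Finset.sum_congr rfl fun c _ => ?_
  rw [integral_const_mul]
  ring

/-- The error covariance restricted to a mode. -/
noncomputable def modeCov (P : Measure Ω) (A : Matrix (Fin n) (Fin n) ℝ)
    (C : Matrix (Fin m) (Fin n) ℝ) (L : Mode m → Matrix (Fin n) (Fin m) ℝ)
    (Q : Matrix (Fin n) (Fin n) ℝ) (R : Matrix (Fin m) (Fin m) ℝ) (S : Matrix (Fin n) (Fin n) ℝ)
    (θ : ℕ → Ω → Mode m) (k : ℕ) (j : Mode m) : Matrix (Fin n) (Fin n) ℝ :=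
  Matrix.of fun a b => ∫ ω, pathCov A C L Q R S (fun l => θ l ω) k a b *
    (if θ k ω = j then 1 else 0) ∂P

/-- The probability of a mode. -/
noncomputable def modeLaw (P : Measure Ω) (θ : ℕ → Ω → Mode m) (k : ℕ) (j : Mode m) : ℝ :=
  ∫ ω, (if θ k ω = j then 1 else 0) ∂P

variable [IsProbabilityMeasure P]

theorem integrable_pathCov_mul (hθ : ∀ k, Measurable (θ k)) (k : ℕ) (a b : Fin n)
    (h : Mode m → ℝ) :
    Integrable (fun ω => pathCov A C L Q R S (fun l => θ l ω) k a b * h (θ k ω)) P := by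
  refine integrable_of_dependsOn hθ (k := k)
    (f := fun θ => pathCov A C L Q R S θ k a b * h (θ k)) fun θ θ' hθθ' => ?_
  have h1 : pathCov A C L Q R S θ k = pathCov A C L Q R S θ' k :=
    dependsOn_pathCov A C L Q R S k fun l hl => hθθ' l (Set.mem_Iic.2 (Set.mem_Iio.1 hl).le)
  simp only [h1, hθθ' k (Set.mem_Iic.2 le_rfl)]

theorem integrable_mode (hθ : ∀ k, Measurable (θ k)) (k : ℕ) (h : Mode m → ℝ) :
    Integrable (fun ω => h (θ k ω)) P :=
  integrable_of_dependsOn hθ (k := k) (f := fun θ => h (θ k)) fun θ θ' hθθ' => by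
    simp only [hθθ' k (Set.mem_Iic.2 le_rfl)]

/-- The Markov property replaces the indicator of `θ (k + 1) = j` by the transition probability from
`θ k`; splitting according to the value of `θ k` then gives the operator and the noise term. -/
theorem isErrorCovariance_modeCov (hp : ∀ i, 0 < p i ∧ p i < 1) (hq : ∀ i, 0 < q i ∧ q i < 1)
    (hθ : ∀ k, Measurable (θ k)) (hM : IsMarkovChain P θ (modeTPM p q)) (hS : 0 ≤ S) :
    IsErrorCovariance A C Q R p q L (modeLaw P θ) S (modeCov P A C L Q R S θ) where
  chain k j := by
    have h := hM.integral_mul_indicator hθ (fun i j => (modeTPM_pos hp hq i j).le)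
      (f := fun _ => 1) (k := k) (fun _ _ _ => rfl) j
    simp only [one_mul] at h
    have h1 : ∀ ω, modeTPM p q (θ k ω) j =
        ∑ i, modeTPM p q i j * (if θ k ω = i then 1 else 0) := fun ω => by simp
    rw [modeLaw, h]
    simp only [h1]
    rw [integral_finsetSum _ fun i _ =>
      (integrable_mode hθ k fun x => if x = i then 1 else 0).const_mul _]
    simp only [integral_const_mul, modeLaw]
  nonneg j := integral_nonneg fun ω => by positivity
  total := by
    simp only [modeLaw]
    rw [← integral_finsetSum _ fun i _ => integrable_mode hθ 0 fun x => if x = i then 1 else 0]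
    simp
  init_nonneg := hS
  init := by
    funext j
    ext a b
    simp only [modeCov, pathCov, Matrix.of_apply, integral_const_mul, modeLaw, Matrix.smul_apply,
      smul_eq_mul, mul_comm]
  step k := by
    funext j
    ext a b
    have hdep : DependsOn (fun θ => pathCov A C L Q R S θ (k + 1) a b) (Set.Iic k) := by
      intro θ θ' h
      have : pathCov A C L Q R S θ (k + 1) = pathCov A C L Q R S θ' (k + 1) :=
        dependsOn_pathCov A C L Q R S (k + 1) fun l hl =>
          h l (Set.mem_Iic.2 (Nat.lt_succ_iff.1 (Set.mem_Iio.1 hl)))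
      simp only [this]
    have h := hM.integral_mul_indicator hθ (fun i j => (modeTPM_pos hp hq i j).le) hdep j
    have h1 : ∀ ω, pathCov A C L Q R S (fun l => θ l ω) (k + 1) a b * modeTPM p q (θ k ω) j =
        ∑ i, modeTPM p q i j * (((errMat A C L i * pathCov A C L Q R S (fun l => θ l ω) k *
          (errMat A C L i)ᵀ) a b * (if θ k ω = i then 1 else 0)) +
          noiseMat Q R L i a b * (if θ k ω = i then 1 else 0)) := fun ω => by
      rw [Finset.sum_eq_single (θ k ω)]
      · simp only [pathCov, Matrix.add_apply, if_true]
        ring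
      · intro i _ hi
        rw [if_neg hi.symm]
        ring
      · simp
    have hi1 : ∀ i c d, Integrable (fun ω => pathCov A C L Q R S (fun l => θ l ω) k c d *
        (if θ k ω = i then 1 else 0)) P := fun i c d =>
      integrable_pathCov_mul hθ k c d fun x => if x = i then 1 else 0
    have hi2 : ∀ i, Integrable (fun ω => (errMat A C L i *
        pathCov A C L Q R S (fun l => θ l ω) k * (errMat A C L i)ᵀ) a b *
          (if θ k ω = i then 1 else 0)) P := fun i => by
      simp only [Matrix.mul_apply, Matrix.transpose_apply, Finset.sum_mul]
      refine integrable_finsetSum _ fun d _ => integrable_finsetSum _ fun c _ => ?_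
      refine ((hi1 i c d).const_mul (errMat A C L i a c * errMat A C L i b d)).congr
        (Eventually.of_forall fun ω => ?_)
      simp only
      ring
    have hi3 : ∀ i, Integrable (fun ω => noiseMat Q R L i a b *
        (if θ k ω = i then 1 else 0)) P := fun i =>
      (integrable_mode hθ k fun x => if x = i then 1 else 0).const_mul _
    have hi4 : ∀ i, Integrable (fun ω => (errMat A C L i *
        pathCov A C L Q R S (fun l => θ l ω) k * (errMat A C L i)ᵀ) a b *
          (if θ k ω = i then 1 else 0) + noiseMat Q R L i a b * (if θ k ω = i then 1 else 0)) P :=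
      fun i => (hi2 i).add (hi3 i)
    have h2 : ∀ X Z : Mode m → Matrix (Fin n) (Fin n) ℝ,
        (mix p q X + mix p q Z) j a b = ∑ i, modeTPM p q i j * (X i a b + Z i a b) :=
      fun X Z => by
        simp [mix, Matrix.sum_apply, Finset.sum_add_distrib, mul_add]
    rw [errOp_apply, h2]
    simp only [modeCov, Matrix.of_apply] at h ⊢
    rw [h]
    simp only [h1]
    rw [integral_finsetSum _ fun i _ => (hi4 i).const_mul _]
    refine Finset.sum_congr rfl fun i _ => ?_
    rw [integral_const_mul, integral_add (hi2 i) (hi3 i), integral_conj_apply (hi1 i),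
      integral_const_mul, Matrix.smul_apply, smul_eq_mul, modeLaw, mul_comm (noiseMat Q R L i a b)]

theorem integral_trace_pathCov (hθ : ∀ k, Measurable (θ k)) (k : ℕ) :
    ∫ ω, (pathCov A C L Q R S (fun l => θ l ω) k).trace ∂P =
      totalTrace n m (modeCov P A C L Q R S θ k) := by
  have hi : ∀ j a, Integrable (fun ω => pathCov A C L Q R S (fun l => θ l ω) k a a *
      (if θ k ω = j then 1 else 0)) P := fun j a =>
    integrable_pathCov_mul hθ k a a fun x => if x = j then 1 else 0
  rw [totalTrace_apply]
  simp only [Matrix.trace, Matrix.diag_apply, modeCov, Matrix.of_apply]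
  rw [Finset.sum_comm, integral_finsetSum _ fun a _ => by
    simpa using integrable_pathCov_mul (A := A) (C := C) (L := L) (Q := Q) (R := R) (S := S)
      hθ k a a fun _ => 1]
  refine Finset.sum_congr rfl fun a _ => ?_
  rw [← integral_finsetSum _ fun j _ => hi j a]
  simp

end ModeAverages

/-! ### Identification of the cost -/

section Cost

theorem integral_mul_eq_zero_of_indepFun {Ω : Type*} [MeasurableSpace Ω] {P : Measure Ω}
    {f g : Ω → ℝ} (h : IndepFun f g P) (hf : MemLp f 2 P) (hg : MemLp g 2 P) (hg0 : ∫ ω, g ω ∂P = 0) :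
    ∫ ω, f ω * g ω ∂P = 0 := by
  rw [h.integral_fun_mul_eq_mul_integral hf.1 hg.1, hg0, mul_zero]

variable {n m : ℕ} {A : Matrix (Fin n) (Fin n) ℝ} {C : Matrix (Fin m) (Fin n) ℝ}
  {Q : Matrix (Fin n) (Fin n) ℝ} {R : Matrix (Fin m) (Fin m) ℝ} {p q : Fin m → ℝ}
  {Ω : Type*} [MeasurableSpace Ω] {P : Measure Ω} [IsProbabilityMeasure P]
  {xbar : Fin n → ℝ} {Pi0 : Matrix (Fin n) (Fin n) ℝ}
  {x₀ : Ω → Fin n → ℝ} {w : ℕ → Ω → Fin n → ℝ} {v : ℕ → Ω → Fin m → ℝ}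
  {γ : Fin m → ℕ → Ω → Bool}

theorem measurable_errPath (L : Mode m → Matrix (Fin n) (Fin m) ℝ) (z₀ : Fin n → ℝ) (k : ℕ) :
    Measurable fun y : (Fin m → ℕ → Bool) × ((Fin n → ℝ) × (ℕ → Fin n → ℝ) × (ℕ → Fin m → ℝ)) =>
      errPath A C L (fun k i => y.1 i k) (y.2.1 - z₀) y.2.2.1 y.2.2.2 k := by
  induction k with
  | zero => exact (measurable_fst.comp measurable_snd).sub_const z₀
  | succ k ih =>
    have hθ : Measurable fun y : (Fin m → ℕ → Bool) ×
        ((Fin n → ℝ) × (ℕ → Fin n → ℝ) × (ℕ → Fin m → ℝ)) => (fun i => y.1 i k : Mode m) := by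
      fun_prop
    have hdisc : ∀ g : Mode m → ℝ, Measurable fun y : (Fin m → ℕ → Bool) ×
        ((Fin n → ℝ) × (ℕ → Fin n → ℝ) × (ℕ → Fin m → ℝ)) => g (fun i => y.1 i k) :=
      fun g => (Measurable.of_discrete (f := g)).comp hθ
    refine measurable_pi_lambda _ fun a => ?_
    simp only [errPath_apply_succ]
    refine (Measurable.add (Finset.measurable_fun_sum _ fun c _ => ?_) ?_).sub
      (Finset.measurable_fun_sum _ fun d _ => ?_)
    · exact (hdisc fun i => errMat A C L i a c).mul ((measurable_pi_apply c).comp ih)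
    · fun_prop
    · refine (hdisc fun i => (L i * dropMat i) a d).mul ?_
      fun_prop

/-- The second moment of the initial error. -/
noncomputable def initSecondMoment (P : Measure Ω) (x₀ : Ω → Fin n → ℝ) (z₀ : Fin n → ℝ) :
    Matrix (Fin n) (Fin n) ℝ :=
  Matrix.of fun a b => ∫ ω, (x₀ ω - z₀) a * (x₀ ω - z₀) b ∂P

theorem IsPacketDropModel.memLp_initError
    (hmodel : IsPacketDropModel P Q R p q xbar Pi0 x₀ w v γ) (z₀ : Fin n → ℝ) (a : Fin n) :
    MemLp (fun ω => (x₀ ω - z₀) a) 2 P :=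
  (hmodel.memLp_init a).sub (memLp_const (z₀ a))

theorem IsPacketDropModel.initSecondMoment_posSemidef
    (hmodel : IsPacketDropModel P Q R p q xbar Pi0 x₀ w v γ) (z₀ : Fin n → ℝ) :
    (initSecondMoment P x₀ z₀).PosSemidef :=
  posSemidef_secondMoment (f := fun a ω => (x₀ ω - z₀) a) (hmodel.memLp_initError z₀)

/-- The cross terms vanish because `x₀ - xbar` has mean zero. Hence a positive definite `Pi0` makes
the initial second moment positive definite for every initial estimate. -/
theorem IsPacketDropModel.initSecondMoment_eq
    (hmodel : IsPacketDropModel P Q R p q xbar Pi0 x₀ w v γ) (z₀ : Fin n → ℝ) :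
    initSecondMoment P x₀ z₀ = Pi0 + Matrix.vecMulVec (xbar - z₀) (star (xbar - z₀)) := by
  ext a b
  have hd : ∀ a, MemLp (fun ω => x₀ ω a - xbar a) 2 P := fun a =>
    (hmodel.memLp_init a).sub (memLp_const (xbar a))
  have hi : ∀ a, Integrable (fun ω => x₀ ω a - xbar a) P := fun a =>
    (hd a).integrable one_le_two
  have hz : ∀ a, ∫ ω, (x₀ ω a - xbar a) ∂P = 0 := fun a => by
    rw [integral_sub ((hmodel.memLp_init a).integrable one_le_two) (integrable_const _),
      hmodel.mean_init]
    simp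
  have h1 : ∀ ω, (x₀ ω - z₀) a * (x₀ ω - z₀) b =
      (x₀ ω a - xbar a) * (x₀ ω b - xbar b) + (xbar b - z₀ b) * (x₀ ω a - xbar a) +
        (xbar a - z₀ a) * (x₀ ω b - xbar b) + (xbar a - z₀ a) * (xbar b - z₀ b) := fun ω => by
    simp only [Pi.sub_apply]
    ring
  have hi1 : Integrable (fun ω => (x₀ ω a - xbar a) * (x₀ ω b - xbar b)) P :=
    (hd a).integrable_mul (hd b)
  have hi2 : Integrable (fun ω => (x₀ ω a - xbar a) * (x₀ ω b - xbar b) +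
      (xbar b - z₀ b) * (x₀ ω a - xbar a)) P := hi1.add ((hi a).const_mul _)
  have hi3 : Integrable (fun ω => (x₀ ω a - xbar a) * (x₀ ω b - xbar b) +
      (xbar b - z₀ b) * (x₀ ω a - xbar a) + (xbar a - z₀ a) * (x₀ ω b - xbar b)) P :=
    hi2.add ((hi b).const_mul _)
  simp only [initSecondMoment, Matrix.of_apply, h1]
  rw [integral_add hi3 (integrable_const _), integral_add hi2 ((hi b).const_mul _),
    integral_add hi1 ((hi a).const_mul _), integral_const_mul, integral_const_mul, hz, hz,
    hmodel.cov_init]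
  simp [Matrix.vecMulVec_apply]

theorem IsPacketDropModel.integral_errPath_mul
    (hmodel : IsPacketDropModel P Q R p q xbar Pi0 x₀ w v γ)
    (L : Mode m → Matrix (Fin n) (Fin m) ℝ) (z₀ : Fin n → ℝ) (θ : ℕ → Mode m) (k : ℕ)
    (a b : Fin n) :
    ∫ ω, errPath A C L θ (x₀ ω - z₀) (fun k => w k ω) (fun k => v k ω) k a *
      errPath A C L θ (x₀ ω - z₀) (fun k => w k ω) (fun k => v k ω) k b ∂P =
      pathCov A C L Q R (initSecondMoment P x₀ z₀) θ k a b := by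
  refine PacketDrop.integral_errPath_mul A C L θ (hmodel.memLp_initError z₀) hmodel.noise_w
    hmodel.noise_v (fun a b => rfl) (fun l a b => ?_) (fun l a b => ?_) (fun k l a b => ?_) k a b
  · refine integral_mul_eq_zero_of_indepFun ?_ (hmodel.memLp_initError z₀ a)
      (hmodel.noise_w.memLp l b) (hmodel.noise_w.mean l b)
    exact hmodel.indep_init.comp (φ := fun x => (x - z₀) a)
      (ψ := fun u : (ℕ → Fin n → ℝ) × (ℕ → Fin m → ℝ) => u.1 l b)
      ((measurable_pi_apply a).comp (measurable_id.sub_const z₀)) (by fun_prop)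
  · refine integral_mul_eq_zero_of_indepFun ?_ (hmodel.memLp_initError z₀ a)
      (hmodel.noise_v.memLp l b) (hmodel.noise_v.mean l b)
    exact hmodel.indep_init.comp (φ := fun x => (x - z₀) a)
      (ψ := fun u : (ℕ → Fin n → ℝ) × (ℕ → Fin m → ℝ) => u.2 l b)
      ((measurable_pi_apply a).comp (measurable_id.sub_const z₀)) (by fun_prop)
  · refine integral_mul_eq_zero_of_indepFun ?_ (hmodel.noise_w.memLp k a)
      (hmodel.noise_v.memLp l b) (hmodel.noise_v.mean l b)
    exact hmodel.indep_noise.comp (φ := fun u : ℕ → Fin n → ℝ => u k a)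
      (ψ := fun u : ℕ → Fin m → ℝ => u l b) (by fun_prop) (by fun_prop)

theorem IsPacketDropModel.lintegral_errPath
    (hmodel : IsPacketDropModel P Q R p q xbar Pi0 x₀ w v γ)
    (L : Mode m → Matrix (Fin n) (Fin m) ℝ) (z₀ : Fin n → ℝ) (θ : ℕ → Mode m) (k : ℕ) :
    ∫⁻ ω, ENNReal.ofReal (‖WithLp.toLp 2
      (errPath A C L θ (x₀ ω - z₀) (fun k => w k ω) (fun k => v k ω) k)‖ ^ 2) ∂P =
      ENNReal.ofReal (pathCov A C L Q R (initSecondMoment P x₀ z₀) θ k).trace := by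
  have hmem := memLp_errPath A C L θ (hmodel.memLp_initError z₀) hmodel.noise_w.memLp
    hmodel.noise_v.memLp k
  have hi : ∀ a, Integrable (fun ω =>
      errPath A C L θ (x₀ ω - z₀) (fun k => w k ω) (fun k => v k ω) k a *
        errPath A C L θ (x₀ ω - z₀) (fun k => w k ω) (fun k => v k ω) k a) P :=
    fun a => (hmem a).integrable_mul (hmem a)
  simp only [EuclideanSpace.real_norm_sq_eq]
  simp only [sq]
  rw [← ofReal_integral_eq_lintegral_ofReal (integrable_finsetSum _ fun a _ => hi a)
    (Eventually.of_forall fun ω => Finset.sum_nonneg fun a _ => mul_self_nonneg _),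
    integral_finsetSum _ fun a _ => hi a]
  simp only [hmodel.integral_errPath_mul, Matrix.trace, Matrix.diag_apply]

/-- Independence makes the joint law of the channels and `(x₀, w, v)` a product. Tonelli then
integrates out the latter for a frozen mode path, which gives the trace of `pathCov`, before
averaging over the path. -/
theorem IsPacketDropModel.cost_eq
    (hmodel : IsPacketDropModel P Q R p q xbar Pi0 x₀ w v γ)
    (L : Mode m → Matrix (Fin n) (Fin m) ℝ) (z₀ : Fin n → ℝ) (k : ℕ) :
    cost P A C x₀ w v γ L z₀ k = ENNReal.ofReal (totalTrace n m
      (modeCov P A C L Q R (initSecondMoment P x₀ z₀) (fun k ω i => γ i k ω) k)) := by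
  have hθ : ∀ k, Measurable fun ω => (fun i => γ i k ω : Mode m) := fun k =>
    measurable_pi_lambda _ fun i => hmodel.measurable_channel i k
  have hγ : Measurable fun ω i k => γ i k ω :=
    measurable_pi_lambda _ fun i => measurable_pi_lambda _ fun k => hmodel.measurable_channel i k
  have hu : Measurable fun ω => (x₀ ω, (fun k => w k ω), (fun k => v k ω)) :=
    hmodel.measurable_init.prodMk ((measurable_pi_lambda _ hmodel.noise_w.measurable).prodMk
      (measurable_pi_lambda _ hmodel.noise_v.measurable))
  have hind := (indepFun_iff_map_prod_eq_prod_map_map hγ.aemeasurable hu.aemeasurable).1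
    hmodel.indep_channels_noise
  let Ψ : (Fin m → ℕ → Bool) × ((Fin n → ℝ) × (ℕ → Fin n → ℝ) × (ℕ → Fin m → ℝ)) → ℝ≥0∞ :=
    fun y => ENNReal.ofReal (‖WithLp.toLp 2
      (errPath A C L (fun k i => y.1 i k) (y.2.1 - z₀) y.2.2.1 y.2.2.2 k)‖ ^ 2)
  have hΨ : Measurable Ψ := by
    have h1 := measurable_errPath (A := A) (C := C) L z₀ k
    simp only [Ψ, EuclideanSpace.real_norm_sq_eq]
    exact ENNReal.measurable_ofReal.comp (Finset.measurable_fun_sum _ fun a _ =>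
      ((measurable_pi_apply a).comp h1).pow_const 2)
  have h1 : cost P A C x₀ w v γ L z₀ k =
      ∫⁻ ω, Ψ ((fun i k => γ i k ω), (x₀ ω, (fun k => w k ω), (fun k => v k ω))) ∂P := by
    simp only [cost, state_sub_estimate, Ψ]
  have h2 : ∀ g : Fin m → ℕ → Bool,
      ∫⁻ ω', Ψ (g, (x₀ ω', (fun k => w k ω'), (fun k => v k ω'))) ∂P =
      ENNReal.ofReal (pathCov A C L Q R (initSecondMoment P x₀ z₀) (fun k i => g i k) k).trace :=
    fun g => hmodel.lintegral_errPath (A := A) (C := C) L z₀ (fun k i => g i k) k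
  rw [h1, ← lintegral_map (f := Ψ) hΨ (hγ.prodMk hu), hind, lintegral_prod _ hΨ.aemeasurable,
    lintegral_map hΨ.lintegral_prod_right' hγ]
  have h3 : ∀ g, ∫⁻ y, Ψ (g, y) ∂(P.map fun ω => (x₀ ω, (fun k => w k ω), (fun k => v k ω))) =
      ∫⁻ ω', Ψ (g, (x₀ ω', (fun k => w k ω'), (fun k => v k ω'))) ∂P := fun g =>
    lintegral_map (hΨ.comp measurable_prodMk_left) hu
  simp only [h3, h2]
  have hnn : ∀ ω, 0 ≤ (pathCov A C L Q R (initSecondMoment P x₀ z₀)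
      (fun k i => γ i k ω) k).trace := fun ω => by
    rw [Matrix.trace]
    refine Finset.sum_nonneg fun a _ => ?_
    rw [Matrix.diag_apply, ← hmodel.integral_errPath_mul]
    exact integral_nonneg fun _ => mul_self_nonneg _
  rw [← ofReal_integral_eq_lintegral_ofReal ?_ (Eventually.of_forall hnn),
    integral_trace_pathCov hθ]
  simp only [Matrix.trace]
  refine integrable_finsetSum _ fun a _ => ?_
  simpa using integrable_pathCov_mul (P := P) (A := A) (C := C) (L := L) (Q := Q) (R := R)
    (S := initSecondMoment P x₀ z₀) hθ k a a fun _ => 1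

/-- The bounds hold only strictly below `a`; letting `r` increase to `a` uses the continuity of
`ENNReal.ofReal`. -/
theorem ofReal_le_liminf_ofReal {u : ℕ → ℝ} {a : ℝ} (h : ∀ r < a, ∀ᶠ k in atTop, r ≤ u k) :
    ENNReal.ofReal a ≤ liminf (fun k => ENNReal.ofReal (u k)) atTop := by
  refine le_of_tendsto (f := fun r => ENNReal.ofReal r) (x := 𝓝[<] a)
    ((ENNReal.continuous_ofReal.tendsto a).mono_left nhdsWithin_le_nhds) ?_
  filter_upwards [self_mem_nhdsWithin] with r hr
  refine le_liminf_of_le (by isBoundedDefault) ?_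
  filter_upwards [h r hr] with k hk using ENNReal.ofReal_le_ofReal hk

end Cost
end PacketDrop

/-! ### The optimality theorem -/

theorem theorem1 {n m : ℕ}
    (A : Matrix (Fin n) (Fin n) ℝ) (C : Matrix (Fin m) (Fin n) ℝ)
    (Q : Matrix (Fin n) (Fin n) ℝ) (hQ : Q.PosSemidef)
    (R : Matrix (Fin m) (Fin m) ℝ) (hR : R.PosDef) (hRdiag : R.IsDiag)
    (p q : Fin m → ℝ) (hp : ∀ i, 0 < p i ∧ p i < 1) (hq : ∀ i, 0 < q i ∧ q i < 1)
    {Ω : Type*} [MeasurableSpace Ω] (P : Measure Ω) [IsProbabilityMeasure P]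
    (xbar : Fin n → ℝ) (Pi0 : Matrix (Fin n) (Fin n) ℝ)
    (x₀ : Ω → Fin n → ℝ) (w : ℕ → Ω → Fin n → ℝ) (v : ℕ → Ω → Fin m → ℝ)
    (γ : Fin m → ℕ → Ω → Bool)
    (hmodel : PacketDrop.IsPacketDropModel P Q R p q xbar Pi0 x₀ w v γ)
    (Y : PacketDrop.Mode m → Matrix (Fin n) (Fin n) ℝ)
    (hY : PacketDrop.IsMSStabilizingSolution A C Q R p q Y) :
    -- the gains `K(Y)` achieve the stationary cost `∑ i, tr (Y i)`, from every initial estimate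
    (∀ z₀ : Fin n → ℝ,
      Tendsto (PacketDrop.cost P A C x₀ w v γ (PacketDrop.kalmanGain A C R p q Y) z₀) atTop
        (𝓝 (ENNReal.ofReal (∑ i, (Y i).trace)))) ∧
    -- no mean-square stable estimator does better, from any initial estimate
    (∀ L : PacketDrop.Mode m → Matrix (Fin n) (Fin m) ℝ, PacketDrop.IsMSStable A C p q L →
      ∀ z₀ : Fin n → ℝ, ENNReal.ofReal (∑ i, (Y i).trace) ≤
        liminf (PacketDrop.cost P A C x₀ w v γ L z₀) atTop) ∧
    -- if the initial covariance is nondegenerate, then no gains at all do better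
    (Pi0.PosDef → ∀ (L : PacketDrop.Mode m → Matrix (Fin n) (Fin m) ℝ) (z₀ : Fin n → ℝ),
      ENNReal.ofReal (∑ i, (Y i).trace) ≤
        liminf (PacketDrop.cost P A C x₀ w v γ L z₀) atTop) := by
  have hM := PacketDrop.isMarkovChain_pi hp hq hmodel.indep_channels hmodel.markov
  have hθ : ∀ k, Measurable fun ω => (fun i => γ i k ω : PacketDrop.Mode m) := fun k =>
    measurable_pi_lambda _ fun i => hmodel.measurable_channel i k
  have hcov : ∀ (L : PacketDrop.Mode m → Matrix (Fin n) (Fin m) ℝ) (z₀ : Fin n → ℝ), _ :=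
    fun L z₀ => PacketDrop.isErrorCovariance_modeCov (A := A) (C := C) (Q := Q) (R := R) (L := L)
      hp hq hθ hM (Matrix.nonneg_iff_posSemidef.2 (hmodel.initSecondMoment_posSemidef z₀))
  have hcost := fun (L : PacketDrop.Mode m → Matrix (Fin n) (Fin m) ℝ) (z₀ : Fin n → ℝ) =>
    funext fun k => hmodel.cost_eq (A := A) (C := C) L z₀ k
  rw [← PacketDrop.totalTrace_apply]
  refine ⟨fun z₀ => ?_, fun L hL z₀ => ?_, fun hPi0 L z₀ => ?_⟩
  · rw [hcost]
    exact (ENNReal.continuous_ofReal.tendsto _).comp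
      ((hcov _ z₀).tendsto_optimal hQ hR hp hq hRdiag hY rfl)
  · rw [hcost]
    exact PacketDrop.ofReal_le_liminf_ofReal fun r hr => (hcov L z₀).eventually_lower_bound
      hQ hR hp hq hY (PacketDrop.tendsto_of_isMSStable hp hq hL) hr
  · rw [hcost]
    have hS : (PacketDrop.initSecondMoment P x₀ z₀).PosDef := by
      rw [hmodel.initSecondMoment_eq]
      exact hPi0.add_posSemidef (Matrix.posSemidef_vecMulVec_self_star _)
    exact PacketDrop.ofReal_le_liminf_ofReal fun r hr =>
      (hcov L z₀).eventually_lower_bound_of_posDef hQ hR hp hq hY hS hr
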